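/- \textbf{Setting.} Let $\mathcal M$ be a Markov decision process with state space $\mathcal S=\mathbb N^D$ (backlogs of $D$ queues), finite non-empty action set $\mathcal A$, transition kernel $p(Q'\mid Q,a)$ under which no queue changes by more than $W\in\mathbb N$ in one step, and cost $c(Q)=\sum_i Q_i$; write $Q_{\max}=\max_i Q_i$. Fix an integer $U>W$ and $\tilde{\mathcal S}=\{Q: Q_{\max}\le U\}$. The truncated MDP $\tilde{\mathcal M}$ has states $\tilde{\mathcal S}$, actions $\mathcal A$, cost $c$ and kernel $\tilde p(Q'\mid Q,a)=\Pr\{\min\{U,Q^+\}=Q'\}$ with $Q^+\sim p(\cdot\mid Q,a)$ and the minimum taken coordinatewise. An optimal policy of an MDP on $\tilde{\mathcal S}$ is a deterministic stationary policy that minimizes the expected long-run average cost, among all (possibly randomized) stationary policies, from every initial state. Let $\pi_0$ be a given stationary policy on $\mathcal S$, let $\beta\ge 1$ and $b_1>0$, and let $\tilde\Phi:\tilde{\mathcal S}\to\mathbb R_+$ satisfy $Q_{\max}^\beta\le\tilde\Phi(Q)\le b_1Q_{\max}^\beta$ for $Q\in\tilde{\mathcal S}$. Put $\mathcal S^{\rm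 in}=\{Q\in\tilde{\mathcal S}:\tilde\Phi(Q)\le (U-W)^\beta\}$. \textbf{Algorithm RL-QN}, with parameters $0<\ell\le 1$ and $L>0$. The initial backlog has an arbitrary distribution, and all counters are $0$ at the start. At the beginning of episode $k=1,2,\dots$ an independent uniform $\xi\in[0,1]$ is drawn. If $\xi\le \ell/\sqrt k$ the episode explores: actions are uniformly random in states of $\tilde{\mathcal S}$, and $\pi_0$ is used elsewhere. Otherwise it exploits: the estimated kernel on $\tilde{\mathcal S}$ is formed from the counters (empirical frequencies for state-action pairs already visited; for the other pairs, the uniform distribution on the states reachable in one step in $\tilde{\mathcal M}$), an optimal policy $\tilde\pi^*_k$ of the estimated MDP is computed, and $\tilde\pi^*_k$ is used on $\mathcal S^{\rm in}$ and $\pi_0$ elsewhere. Episode $k$ lasts as long as the number of visits to $\mathcal S^{\rm in}$ within it is smaller than $L\sqrt k$. In every time slot $t$ (of either kind of episode) with $Q(t)\in\tilde{\mathcal S}$, the transition $(Q(t),a_t)\to\min\{U,Q(t+1)\}$ is added to the counters. \textbf{Assumptions.} (1) ($\pi_0$ is stabilizing.) There are $\Phi_0:\mathcal S\to\mathbb R_+$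 and $a,\alpha,\epsilon_0,B_0>0$ with $\Phi_0(Q)\le aQ_{\max}^\alpha$ for all $Q$, and $\mathbb E_{\pi_0}[\Phi_0(Q(t+1))-\Phi_0(Q(t))\mid Q(t)=Q]\le-\epsilon_0$ whenever $Q_{\max}\ge B_0$. (2) (Error tolerance.) There are a policy $\tilde\pi^*$ and $\Delta p>0$ such that for every transition kernel $\tilde p'$ on $\tilde{\mathcal S}$ with $\|\tilde p(\cdot\mid Q,a)-\tilde p'(\cdot\mid Q,a)\|_1\le\Delta p$ for all $Q\in\tilde{\mathcal S}$, $a\in\mathcal A$, the policy $\tilde\pi^*$ is the unique optimal policy of the MDP on $\tilde{\mathcal S}$ with kernel $\tilde p'$, actions $\mathcal A$ and cost $c$ (in particular, $\tilde\pi^*$ is the optimal policy of $\tilde{\mathcal M}$). (3) (Communication.) In $\mathcal M$, all states are accessible from each other under the policy that is uniformly random on $\tilde{\mathcal S}$ and equals $\pi_0$ elsewhere, and also under the policy that equals $\tilde\pi^*$ on $\mathcal S^{\rm in}$ and $\pi_0$ elsewhere. \textbf{Theorem.} Under these assumptions, for every $\delta\in(0,1)$ there is a finite $k^*$ such that, with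 probability at least $1-\delta$, RL-QN reaches episode $k^*$, exploits in it, and the estimated optimal policy that it computes at the beginning of this episode is the optimal policy of the truncated MDP: $\tilde\pi^*_{k^*}=\tilde\pi^*$. In particular, RL-QN learns $\tilde\pi^*$ within $k^*$ episodes with probability at least $1-\delta$. -/

import Mathlib

open MeasureTheory Filter Topology
open scoped ENNReal NNReal

noncomputable section

namespace RLQN

/-- Queue backlog vectors of `D` queues: the state space `ℕ^D`. -/
abbrev Backlog (D : ℕ) : Type := Fin D → ℕ

/-- The states of the truncated system: backlog vectors all of whose entries are at most `U`. -/
abbrev TState (D U : ℕ) : Type := Fin D → Fin (U + 1)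

/-- The largest entry of a backlog vector. -/
def qmax {D : ℕ} (Q : Backlog D) : ℕ := Finset.univ.sup Q

/-- A truncated state, seen as a backlog vector. -/
def emb {D U : ℕ} (q : TState D U) : Backlog D := fun i => (q i : ℕ)

/-- The coordinatewise minimum `min {U, Q}`. -/
def clip {D : ℕ} (U : ℕ) (Q : Backlog D) : TState D U :=
  fun i => ⟨min U (Q i), Nat.lt_succ_of_le (min_le_left _ _)⟩

/-- The set of backlog vectors that belong to the truncated state space. -/
def truncSet (D U : ℕ) : Set (Backlog D) := {Q | ∀ i, Q i ≤ U}

/-- The queueing network as a Markov decision process with state space `ℕ^D` and action space `A`: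
a transition kernel under which no queue changes by more than `W` in one time slot.
The cost of a state is its total backlog. -/
structure QueueMDP (D : ℕ) (A : Type*) where
  p : Backlog D → A → PMF (Backlog D)
  W : ℕ
  bounded_jump : ∀ Q a Q', p Q a Q' ≠ 0 → ∀ i, |(Q' i : ℤ) - (Q i : ℤ)| ≤ (W : ℤ)

/-- One-step law from state `x` under the stationary (possibly randomized) policy `π`. -/
def chainStep {S A : Type*} (p : S → A → PMF S) (π : S → PMF A) (x : S) : PMF S :=
  (π x).bind fun a => p x a

/-- All states are accessible from each other under the stationary policy `π`. -/
def IrreducibleUnder {S A : Type*} (p : S → A → PMF S) (π : S → PMF A) : Prop :=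
  ∀ x y : S, Relation.ReflTransGen (fun u v => chainStep p π u v ≠ 0) x y

/-- `π₀` is stabilizing: a nonnegative Lyapunov function of polynomial growth has drift at most
`-ε₀` at all states whose largest entry is at least `B₀`.  (The sum has only finitely many nonzero
terms, because jumps are bounded.) -/
def IsStabilizing {D : ℕ} {A : Type*} (M : QueueMDP D A) (π₀ : Backlog D → PMF A) : Prop :=
  ∃ (Φ₀ : Backlog D → ℝ) (a α ε₀ B₀ : ℝ), 0 < a ∧ 0 < α ∧ 0 < ε₀ ∧ 0 < B₀ ∧
    (∀ Q, 0 ≤ Φ₀ Q) ∧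
    (∀ Q, Φ₀ Q ≤ a * (qmax Q : ℝ) ^ α) ∧
    (∀ Q, B₀ ≤ (qmax Q : ℝ) →
      (∑' Q', (chainStep M.p π₀ Q Q').toReal * Φ₀ Q') - Φ₀ Q ≤ -ε₀)

/-! ### The truncated system and average-cost optimality -/

/-- Transition kernels on the truncated state space. -/
abbrev TKernel (D U : ℕ) (A : Type*) : Type _ := TState D U → A → PMF (TState D U)

/-- The kernel of the truncated system: the dynamics of the network, where each queue has a buffer
of size `U` and overflowing packets are dropped. -/
def truncKernel {D : ℕ} {A : Type*} (M : QueueMDP D A) (U : ℕ) : TKernel D U A :=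
  fun q a => (M.p (emb q) a).map (clip U)

/-- The cost (total backlog) of a truncated state. -/
def cost {D U : ℕ} (q : TState D U) : ℝ := ∑ i, ((q i : ℕ) : ℝ)

/-- The law of the state at time `t` when starting at `q`, under kernel `P` and policy `σ`. -/
def lawAt {D U : ℕ} {A : Type*} (P : TKernel D U A) (σ : TState D U → PMF A) (q : TState D U) :
    ℕ → PMF (TState D U)
  | 0 => PMF.pure q
  | t + 1 => (lawAt P σ q t).bind (chainStep P σ)

/-- Expected long-run average cost from the initial state `q`. -/
def avgCost {D U : ℕ} {A : Type*} (P : TKernel D U A) (σ : TState D U → PMF A)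
    (q : TState D U) : ℝ :=
  limsup (fun T : ℕ =>
    (∑ t ∈ Finset.range T, ∑ q', (lawAt P σ q t q').toReal * cost q') / (T : ℝ)) atTop

/-- The deterministic stationary policy `π` minimizes the expected average cost from every initial
state, among all (possibly randomized) stationary policies. -/
def IsOptimal {D U : ℕ} {A : Type*} (P : TKernel D U A) (π : TState D U → A) : Prop :=
  ∀ (σ : TState D U → PMF A) (q : TState D U),
    avgCost P (fun x => PMF.pure (π x)) q ≤ avgCost P σ q

/-- The error-tolerance assumption for the optimal policy `πopt` of the truncated system: for every
kernel that is `Δ`-close in `L¹` at each state-action pair (in particular for the true one),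
`πopt` is the optimal policy. -/
def ErrorTolerant {D : ℕ} {A : Type*} (M : QueueMDP D A) (U : ℕ) (πopt : TState D U → A) : Prop :=
  ∃ Δ : ℝ, 0 < Δ ∧ ∀ P' : TKernel D U A,
    (∀ q a, ∑ q', |(truncKernel M U q a q').toReal - (P' q a q').toReal| ≤ Δ) →
    ∀ π : TState D U → A, IsOptimal P' π ↔ π = πopt

/-- A procedure that returns an optimal policy of every MDP on the truncated state space that has
one. -/
def IsExactSolver {D U : ℕ} {A : Type*} (solve : TKernel D U A → (TState D U → A)) : Prop :=
  ∀ P, (∃ π, IsOptimal P π) → IsOptimal P (solve P)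

/-! ### The algorithm -/

/-- The network together with the inputs of RL-QN: the known policy `π₀`, the threshold `U`, the
function `Φ` and its order `β` (which determine the region of exploitation), the tuning parameters
`ℓ` and `L`, and the routine that solves the estimated MDPs. -/
structure Setup (D : ℕ) (A : Type*) where
  M : QueueMDP D A
  π₀ : Backlog D → PMF A
  U : ℕ
  W_lt_U : M.W < U
  Φ : TState D U → ℝ
  β : ℝ
  ℓ : ℝ
  ℓ_pos : 0 < ℓ
  ℓ_le_one : ℓ ≤ 1
  L : ℝ
  L_pos : 0 < L
  solve : TKernel D U A → (TState D U → A)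

variable {D : ℕ} {A : Type*}

/-- `Φ` has order `β`: `β ≥ 1` and `Q_max ^ β ≤ Φ Q ≤ b₁ * Q_max ^ β` on the truncated states. -/
def Setup.HasOrder (R : Setup D A) : Prop :=
  1 ≤ R.β ∧ ∃ b₁ : ℝ, 0 < b₁ ∧ ∀ q : TState D R.U,
    (qmax (emb q) : ℝ) ^ R.β ≤ R.Φ q ∧ R.Φ q ≤ b₁ * (qmax (emb q) : ℝ) ^ R.β

/-- The region `S^in`, where the estimated optimal policy is applied. -/
def Setup.Sin (R : Setup D A) : Set (Backlog D) :=
  {Q | Q ∈ truncSet D R.U ∧ R.Φ (clip R.U Q) ≤ ((R.U : ℝ) - (R.M.W : ℝ)) ^ R.β}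

open Classical in
/-- The policy of an exploration episode: uniformly random actions on the truncated state space,
`π₀` elsewhere. -/
def Setup.explorePolicy [Fintype A] [Nonempty A] (R : Setup D A) (Q : Backlog D) : PMF A :=
  if Q ∈ truncSet D R.U then PMF.uniformOfFintype A else R.π₀ Q

open Classical in
/-- The policy of an exploitation episode: `π` on `S^in`, `π₀` elsewhere. -/
def Setup.exploitPolicy (R : Setup D A) (π : TState D R.U → A) (Q : Backlog D) : PMF A :=
  if Q ∈ R.Sin then PMF.pure (π (clip R.U Q)) else R.π₀ Q

/-- Transition counters: `c q a q'` is the number of recorded transitions from `q` to `q'` under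
action `a`. -/
abbrev Counts (D U : ℕ) (A : Type*) : Type _ := TState D U → A → TState D U → ℕ

/-- The number of recorded visits to a state-action pair. -/
def visits {U : ℕ} (c : Counts D U A) (q : TState D U) (a : A) : ℕ := ∑ q', c q a q'

open Classical in
/-- Truncated states that are reachable from `q` in one step of the truncated system. -/
def Setup.reach (R : Setup D A) (q : TState D R.U) : Finset (TState D R.U) :=
  Finset.univ.filter fun q' => ∃ a, truncKernel R.M R.U q a q' ≠ 0

theorem Setup.reach_nonempty [Nonempty A] (R : Setup D A) (q : TState D R.U) :
    (R.reach q).Nonempty := by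
  obtain ⟨a⟩ := (inferInstance : Nonempty A)
  obtain ⟨q', hq'⟩ := (truncKernel R.M R.U q a).support_nonempty
  exact ⟨q', by
    simp only [Setup.reach, Finset.mem_filter, Finset.mem_univ, true_and]
    exact ⟨a, (PMF.mem_support_iff _ _).1 hq'⟩⟩

theorem sum_freq_eq_one {U : ℕ} (c : Counts D U A) (q : TState D U) (a : A)
    (h : ¬ visits c q a = 0) :
    ∑ q', (c q a q' : ℝ≥0∞) / (visits c q a : ℝ≥0∞) = 1 := by
  simp only [div_eq_mul_inv]
  rw [← Finset.sum_mul, ← Nat.cast_sum]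
  exact ENNReal.mul_inv_cancel (by exact_mod_cast h) (ENNReal.natCast_ne_top _)

open Classical in
/-- The estimated kernel: empirical frequencies for the pairs that have been visited, and the
uniform distribution on the one-step reachable set for the others. -/
def Setup.estimate [Nonempty A] (R : Setup D A) (c : Counts D R.U A) : TKernel D R.U A :=
  fun q a =>
    if h : visits c q a = 0 then PMF.uniformOfFinset (R.reach q) (R.reach_nonempty q)
    else PMF.ofFintype (fun q' => (c q a q' : ℝ≥0∞) / (visits c q a : ℝ≥0∞))
      (sum_freq_eq_one c q a h)

/-- The exploration probability `ℓ / √k` of episode `k`. -/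
def Setup.exploreProb (R : Setup D A) (k : ℕ) : ℝ := R.ℓ / Real.sqrt k

theorem Setup.exploreProb_le_one (R : Setup D A) (k : ℕ) : R.exploreProb k ≤ 1 := by
  unfold Setup.exploreProb
  rcases Nat.eq_zero_or_pos k with rfl | hk
  · simp
  · have h1 : (1 : ℝ) ≤ Real.sqrt k := Real.one_le_sqrt.2 (by exact_mod_cast hk)
    exact (div_le_one (by linarith)).2 (R.ℓ_le_one.trans h1)

/-- A coin that shows `true` with probability `x`. -/
def coin (x : ℝ) (hx : x ≤ 1) : PMF Bool :=
  PMF.ofFintype (fun b => bif b then ENNReal.ofReal x else 1 - ENNReal.ofReal x) (by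
    have h : ENNReal.ofReal x ≤ 1 := by simpa using ENNReal.ofReal_le_ofReal hx
    simp [add_tsub_cancel_of_le h])

/-- The complete state of a run of RL-QN at one time slot. -/
@[ext] structure RunState (D U : ℕ) (A : Type*) where
  /-- the current backlog -/
  Q : Backlog D
  /-- the transition counters -/
  counts : Counts D U A
  /-- the number of the current episode -/
  episode : ℕ
  /-- the number of visits to `S^in` in the current episode so far -/
  inVisits : ℕ
  /-- `none` in an exploration episode; `some π` in an exploitation episode, where `π` is the
  estimated optimal policy computed at its beginning -/
  plan : Option (TState D U → A)

instance {U : ℕ} : MeasurableSpace (RunState D U A) := ⊤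

/-- The choice made at the beginning of episode `k`, with the counters at that time: explore with
probability `ℓ / √k` (this is the event `ξ ≤ ℓ / √k` for a uniform `ξ` in `[0, 1]`), and otherwise
exploit with the policy obtained by solving the estimated MDP. -/
def Setup.drawPlan [Nonempty A] (R : Setup D A) (k : ℕ) (c : Counts D R.U A) :
    PMF (Option (TState D R.U → A)) :=
  (coin (R.exploreProb k) (R.exploreProb_le_one k)).map
    fun b => if b = true then none else some (R.solve (R.estimate c))

/-- The distribution of the action in the current time slot. -/
def Setup.action [Fintype A] [Nonempty A] (R : Setup D A) (s : RunState D R.U A) : PMF A :=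
  match s.plan with
  | none => R.explorePolicy s.Q
  | some π => R.exploitPolicy π s.Q

open Classical in
/-- The counters after taking action `a` and observing the next backlog `Q'`: if the current
backlog is a truncated state, the transition to `min {U, Q'}` is recorded. -/
def Setup.newCounts (R : Setup D A) (s : RunState D R.U A) (a : A) (Q' : Backlog D) :
    Counts D R.U A :=
  fun q b q' =>
    if s.Q ∈ truncSet D R.U ∧ q = clip R.U s.Q ∧ b = a ∧ q' = clip R.U Q' then s.counts q b q' + 1
    else s.counts q b q'

open Classical in
/-- The number of visits to `S^in` in the current episode, including the current time slot. -/
def Setup.newVisits (R : Setup D A) (s : RunState D R.U A) : ℕ :=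
  if s.Q ∈ R.Sin then s.inVisits + 1 else s.inVisits

open Classical in
/-- Bookkeeping after taking action `a` and observing `Q'`: the episode `k` goes on as long as the
number of visits to `S^in` is smaller than `L * √k`; otherwise episode `k + 1` begins. -/
def Setup.update [Nonempty A] (R : Setup D A) (s : RunState D R.U A) (a : A) (Q' : Backlog D) :
    PMF (RunState D R.U A) :=
  if (R.newVisits s : ℝ) < R.L * Real.sqrt s.episode then
    PMF.pure ⟨Q', R.newCounts s a Q', s.episode, R.newVisits s, s.plan⟩
  else
    (R.drawPlan (s.episode + 1) (R.newCounts s a Q')).map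
      fun m => ⟨Q', R.newCounts s a Q', s.episode + 1, 0, m⟩

/-- One time slot of RL-QN. -/
def Setup.step [Fintype A] [Nonempty A] (R : Setup D A) (s : RunState D R.U A) :
    PMF (RunState D R.U A) :=
  (R.action s).bind fun a => (R.M.p s.Q a).bind fun Q' => R.update s a Q'

/-- The law of the initial state of a run whose initial backlog has law `μ₀`: all counters are
zero and episode `1` begins. -/
def Setup.start [Nonempty A] (R : Setup D A) (μ₀ : PMF (Backlog D)) : PMF (RunState D R.U A) :=
  μ₀.bind fun Q => (R.drawPlan 1 (fun _ _ _ => 0)).map fun m => ⟨Q, fun _ _ _ => 0, 1, 0, m⟩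

/-- The process `X` is a run of RL-QN with initial backlog law `μ₀`: it is the Markov chain with
initial law `R.start μ₀` and transition probabilities `R.step`. -/
structure Setup.IsRun [Fintype A] [Nonempty A] (R : Setup D A) (μ₀ : PMF (Backlog D))
    {Ω : Type*} [MeasurableSpace Ω] (P : Measure Ω) (X : ℕ → Ω → RunState D R.U A) : Prop where
  measurable : ∀ t, Measurable (X t)
  initial : ∀ s, P {ω | X 0 ω = s} = R.start μ₀ s
  transition : ∀ (t : ℕ) (x : ℕ → RunState D R.U A),
    P {ω | ∀ i ≤ t + 1, X i ω = x i} = P {ω | ∀ i ≤ t, X i ω = x i} * R.step (x t) (x (t + 1))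

end RLQN

end

noncomputable section

namespace RLQN

set_option linter.unusedSectionVars false

/-! ### Expectations under discrete laws and hitting probabilities -/

/-! The run is a Markov chain on a countable space, and every probability is treated as a hitting
probability `hit`, viewed as a function of the initial state. Such a function is the smallest
superharmonic one that is at least `1` on the target. Hence upper bounds come from exhibiting
supermartingales (`hit_le_of_superharmonic`), and lower bounds from the fact that `hit` is itself
superharmonic (`expect_hit_le`). Only `measure_exists_mem_eq` returns to the measure `P`.

Two facts are combined for a large fixed `k`. The first is that episode `k` is reached almost surely
(`Setup.hit_episode`). Outside the finite truncated space every plan uses `π₀`, so Foster's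
criterion and irreducibility bring the backlog back to `S^in`, and an episode needs only finitely
many visits there. Irreducibility is available only for exploration and for `πopt`, but all
exploiting plans agree outside `S^in`.

The second is that being in episode `k` with a plan other than `πopt` has probability at most `δ`
(`Setup.exists_hit_wrong_plan_le`). There are three causes, each allotted `δ / 3`. Episode `k`
explores: this has probability `ℓ / √k`. Some pair has fewer than `n₀` records: a late exploration
episode records a given pair with probability at least `η`, and since `∑ ℓ / √j` diverges, the
potential `2 ^ n₀ * 2⁻¹ ^ visits` is driven to zero in mean, as in a conditional Borel–Cantelli
argument (`Setup.hitBy_sparseSet_le`). Some frequency is far off after `n₀` or more records: an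
exponential supermartingale and a maximal inequality bound this uniformly in time, so adaptive
actions and random episode lengths do no harm (`Setup.hit_deviationSet_le`). If none of these
occurs, the estimate is within the error tolerance and the solver must return `πopt`. -/

/-- The expectation of a nonnegative function under a discrete law. -/
def expect {S : Type*} (μ : PMF S) (f : S → ℝ≥0∞) : ℝ≥0∞ := ∑' x, μ x * f x

section Expect

variable {S T : Type*}

theorem expect_mono (μ : PMF S) {f g : S → ℝ≥0∞} (h : ∀ x, f x ≤ g x) :
    expect μ f ≤ expect μ g :=
  ENNReal.tsum_le_tsum fun x => mul_le_mul_right (h x) _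

theorem expect_const (μ : PMF S) (c : ℝ≥0∞) : expect μ (fun _ => c) = c := by
  simp [expect, ENNReal.tsum_mul_right, μ.tsum_coe]

theorem expect_add (μ : PMF S) (f g : S → ℝ≥0∞) :
    expect μ (fun x => f x + g x) = expect μ f + expect μ g := by
  simp [expect, mul_add, ENNReal.tsum_add]

theorem expect_const_mul (μ : PMF S) (c : ℝ≥0∞) (f : S → ℝ≥0∞) :
    expect μ (fun x => c * f x) = c * expect μ f := by
  simp only [expect, ← ENNReal.tsum_mul_left]
  exact tsum_congr fun x => by ring

theorem expect_sum {ι : Type*} (s : Finset ι) (μ : PMF S) (f : ι → S → ℝ≥0∞) :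
    expect μ (fun x => ∑ i ∈ s, f i x) = ∑ i ∈ s, expect μ (f i) := by
  classical
  induction s using Finset.induction_on with
  | empty => simp [expect_const]
  | insert i s hi ih => simp [Finset.sum_insert hi, expect_add, ih]

theorem expect_pure (x : S) (f : S → ℝ≥0∞) : expect (PMF.pure x) f = f x := by
  classical
  rw [expect, tsum_eq_single x]
  · simp
  · intro y hy
    simp [hy]

theorem expect_bind (μ : PMF S) (k : S → PMF T) (f : T → ℝ≥0∞) :
    expect (μ.bind k) f = expect μ fun x => expect (k x) f := by
  simp only [expect, PMF.bind_apply, ← ENNReal.tsum_mul_right, ← ENNReal.tsum_mul_left]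
  rw [ENNReal.tsum_comm]
  exact tsum_congr fun x => tsum_congr fun y => by ring

theorem expect_map (μ : PMF S) (g : S → T) (f : T → ℝ≥0∞) :
    expect (μ.map g) f = expect μ fun x => f (g x) := by
  simp [PMF.map, expect_bind, expect_pure]

theorem le_expect_of_forall (μ : PMF S) {f : S → ℝ≥0∞} {c : ℝ≥0∞} (h : ∀ x, c ≤ f x) :
    c ≤ expect μ f :=
  (expect_const μ c).symm.le.trans (expect_mono μ h)

theorem expect_le_of_forall (μ : PMF S) {f : S → ℝ≥0∞} {c : ℝ≥0∞} (h : ∀ x, f x ≤ c) :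
    expect μ f ≤ c :=
  (expect_mono μ h).trans (expect_const μ c).le

theorem mul_le_expect (μ : PMF S) (f : S → ℝ≥0∞) (x : S) : μ x * f x ≤ expect μ f :=
  ENNReal.le_tsum (f := fun x => μ x * f x) x

/-- Monotone convergence for the counting measure on the discrete σ-algebra. -/
theorem expect_iSup (μ : PMF S) {f : ℕ → S → ℝ≥0∞} (hf : Monotone f) :
    expect μ (fun x => ⨆ n, f n x) = ⨆ n, expect μ (f n) := by
  let _ : MeasurableSpace S := ⊤
  have key : ∀ g : S → ℝ≥0∞, expect μ g = ∫⁻ x, μ x * g x ∂Measure.count := fun g => by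
    rw [lintegral_count]; rfl
  simp only [key]
  simp only [ENNReal.mul_iSup]
  exact lintegral_iSup (fun n => measurable_from_top)
    fun m n hmn x => mul_le_mul_right (hf hmn x) _

end Expect

/-! ### Hitting probabilities as minimal superharmonic functions. -/

section Hitting

variable {S : Type*}

open Classical in
/-- The probability of visiting `B` within `n` steps, as a function of the initial state. -/
def hitBy (K : S → PMF S) (B : Set S) : ℕ → S → ℝ≥0∞
  | 0, x => if x ∈ B then 1 else 0
  | n + 1, x => if x ∈ B then 1 else expect (K x) (hitBy K B n)

/-- The probability of ever visiting `B`, as a function of the initial state. -/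
def hit (K : S → PMF S) (B : Set S) (x : S) : ℝ≥0∞ := ⨆ n, hitBy K B n x

variable {K : S → PMF S} {B : Set S}

theorem hitBy_of_mem {x : S} (hx : x ∈ B) (n : ℕ) : hitBy K B n x = 1 := by
  cases n <;> simp [hitBy, hx]

theorem hitBy_zero_of_notMem {x : S} (hx : x ∉ B) : hitBy K B 0 x = 0 := by
  simp [hitBy, hx]

theorem hitBy_succ_of_notMem {x : S} (hx : x ∉ B) (n : ℕ) :
    hitBy K B (n + 1) x = expect (K x) (hitBy K B n) := by
  simp [hitBy, hx]

theorem hitBy_le_succ (n : ℕ) (x : S) : hitBy K B n x ≤ hitBy K B (n + 1) x := by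
  induction n generalizing x with
  | zero =>
    by_cases hx : x ∈ B
    · simp [hitBy_of_mem hx]
    · simp [hitBy_zero_of_notMem hx]
  | succ n ih =>
    by_cases hx : x ∈ B
    · simp [hitBy_of_mem hx]
    · rw [hitBy_succ_of_notMem hx, hitBy_succ_of_notMem hx]
      exact expect_mono _ ih

theorem hitBy_mono : Monotone (hitBy K B) :=
  monotone_nat_of_le_succ fun n x => hitBy_le_succ n x

theorem hitBy_le_hit (n : ℕ) (x : S) : hitBy K B n x ≤ hit K B x :=
  le_iSup (fun n => hitBy K B n x) n

/-- The hitting probability is the smallest nonnegative function that is at least `1` on `B` and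
superharmonic outside `B`. -/
theorem hitBy_le_of_superharmonic {G : S → ℝ≥0∞} (h1 : ∀ x ∈ B, 1 ≤ G x)
    (h2 : ∀ x, x ∉ B → expect (K x) G ≤ G x) (n : ℕ) (x : S) : hitBy K B n x ≤ G x := by
  induction n generalizing x with
  | zero =>
    by_cases hx : x ∈ B
    · simpa [hitBy_of_mem hx] using h1 x hx
    · simp [hitBy_zero_of_notMem hx]
  | succ n ih =>
    by_cases hx : x ∈ B
    · simpa [hitBy_of_mem hx] using h1 x hx
    · rw [hitBy_succ_of_notMem hx]
      exact (expect_mono _ ih).trans (h2 x hx)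

theorem hit_le_of_superharmonic {G : S → ℝ≥0∞} (h1 : ∀ x ∈ B, 1 ≤ G x)
    (h2 : ∀ x, x ∉ B → expect (K x) G ≤ G x) (x : S) : hit K B x ≤ G x :=
  iSup_le fun n => hitBy_le_of_superharmonic h1 h2 n x

theorem hit_le_one (x : S) : hit K B x ≤ 1 :=
  hit_le_of_superharmonic (fun _ _ => le_rfl) (fun x _ => (expect_const (K x) 1).le) x

theorem hitBy_le_one (n : ℕ) (x : S) : hitBy K B n x ≤ 1 :=
  (hitBy_le_hit n x).trans (hit_le_one x)

theorem hit_of_mem {x : S} (hx : x ∈ B) : hit K B x = 1 := by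
  simp [hit, hitBy_of_mem hx]

theorem hit_le_expect {x : S} (hx : x ∉ B) : hit K B x ≤ expect (K x) (hit K B) := by
  refine iSup_le fun n => ?_
  cases n with
  | zero => simp [hitBy_zero_of_notMem hx]
  | succ n =>
    rw [hitBy_succ_of_notMem hx]
    exact expect_mono _ (hitBy_le_hit n)

/-- Off `B` this is first-step analysis and monotone convergence; on `B` it holds because `hit`
never exceeds `1`. Together with `hit_le_expect` it gives harmonicity off `B`. -/
theorem expect_hit_le (x : S) : expect (K x) (hit K B) ≤ hit K B x := by
  by_cases hx : x ∈ B
  · rw [hit_of_mem hx]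
    exact expect_le_of_forall _ hit_le_one
  · have h : expect (K x) (hit K B) = ⨆ n, expect (K x) (hitBy K B n) :=
      expect_iSup (K x) hitBy_mono
    rw [h]
    refine iSup_le fun n => ?_
    rw [← hitBy_succ_of_notMem hx]
    exact hitBy_le_hit (n + 1) x

/-- Go to `B` first and from there to `C`: a substitute for the strong Markov property. -/
theorem mul_hit_le_hit {C : Set S} {c : ℝ≥0∞} (h : ∀ x ∈ B, c ≤ hit K C x) (x : S) :
    c * hit K B x ≤ hit K C x := by
  rw [hit, ENNReal.mul_iSup]
  refine iSup_le fun n => ?_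
  induction n generalizing x with
  | zero =>
    by_cases hx : x ∈ B
    · simpa [hitBy_of_mem hx] using h x hx
    · simp [hitBy_zero_of_notMem hx]
  | succ n ih =>
    by_cases hx : x ∈ B
    · simpa [hitBy_of_mem hx] using h x hx
    · rw [hitBy_succ_of_notMem hx, ← expect_const_mul]
      exact (expect_mono _ ih).trans (expect_hit_le x)

theorem hitBy_congr {K' : S → PMF S} (h : ∀ x, x ∉ B → K x = K' x) (n : ℕ) (x : S) :
    hitBy K B n x = hitBy K' B n x := by
  induction n generalizing x with
  | zero => rfl
  | succ n ih =>
    by_cases hx : x ∈ B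
    · simp [hitBy_of_mem hx]
    · rw [hitBy_succ_of_notMem hx, hitBy_succ_of_notMem hx, h x hx]
      exact congrArg _ (funext ih)

theorem hit_congr {K' : S → PMF S} (h : ∀ x, x ∉ B → K x = K' x) (x : S) :
    hit K B x = hit K' B x := by
  simp only [hit, hitBy_congr h]

/-- A set that is hit with probability bounded away from zero is hit almost surely. -/
theorem hit_eq_one_of_le {c : ℝ≥0∞} (hc : c ≠ 0) (h : ∀ x, c ≤ hit K B x) (x : S) :
    hit K B x = 1 := by
  have hc1 : c ≤ 1 := (h x).trans (hit_le_one x)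
  have hct : c ≠ ∞ := ne_top_of_le_ne_top ENNReal.one_ne_top hc1
  have hsum : 1 - c + c = 1 := tsub_add_cancel_of_le hc1
  -- As `n` grows this becomes `(1 - c) * h + c ≤ h` for `h = hit K B x`, that is `c ≤ c * h`, which
  -- forces `h = 1`.
  have key : ∀ n x, (1 - c) * hitBy K B n x + c ≤ hit K B x := by
    intro n
    induction n with
    | zero =>
      intro x
      by_cases hx : x ∈ B
      · simp [hitBy_of_mem hx, hit_of_mem hx, hsum]
      · simpa [hitBy_zero_of_notMem hx] using h x
    | succ n ih =>
      intro x
      by_cases hx : x ∈ B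
      · simp [hitBy_of_mem hx, hit_of_mem hx, hsum]
      · rw [hitBy_succ_of_notMem hx, ← expect_const_mul, ← expect_const (K x) c, ← expect_add,
          expect_const]
        exact (expect_mono _ ih).trans (expect_hit_le x)
  have hx : (1 - c) * hit K B x + c ≤ hit K B x := by
    rw [hit, ENNReal.mul_iSup, ENNReal.iSup_add]
    exact iSup_le fun n => key n x
  have hx' : (1 - c) * hit K B x + c ≤ (1 - c) * hit K B x + c * hit K B x := by
    rwa [← add_mul, hsum, one_mul]
  have hfin : (1 - c) * hit K B x ≠ ∞ :=
    ne_top_of_le_ne_top ENNReal.one_ne_top (mul_le_one' tsub_le_self (hit_le_one x))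
  have hle : c * 1 ≤ c * hit K B x := by
    rw [mul_one]
    exact (ENNReal.add_le_add_iff_left hfin).1 hx'
  exact le_antisymm (hit_le_one x) ((ENNReal.mul_le_mul_iff_right hc hct).1 hle)

theorem hit_pos_of_reflTransGen {x y : S} (h : Relation.ReflTransGen (fun u v => K u v ≠ 0) x y)
    (hy : y ∈ B) : hit K B x ≠ 0 := by
  induction h using Relation.ReflTransGen.head_induction_on with
  | refl => simp [hit_of_mem hy]
  | @head u v hxz _ ih =>
    intro h0
    have h1 := (mul_le_expect (K u) (hit K B) v).trans (expect_hit_le (K := K) (B := B) u)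
    rw [h0] at h1
    exact mul_ne_zero hxz ih (le_antisymm h1 zero_le)

/-- Foster's criterion, recurrence part: a set outside which a nonnegative function has drift at
most `-ε` is hit almost surely. -/
theorem hit_eq_one_of_drift {Φ : S → ℝ≥0∞} {ε : ℝ≥0∞} (hε : ε ≠ 0) (hε' : ε ≠ ∞)
    (hΦ : ∀ x, Φ x ≠ ∞)
    (hdrift : ∀ x, x ∉ B → expect (K x) Φ + ε ≤ Φ x) (x : S) : hit K B x = 1 := by
  have key : ∀ (n : ℕ) (x : S), (n : ℝ≥0∞) * ε ≤ Φ x + n * ε * hit K B x := by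
    -- For the hitting time `T`, the drift gives `ε * E[min T n] ≤ Φ x`, hence `n * ε * P(T > n) ≤ Φ
    -- x`. This is that bound written without subtraction.
    have aux : ∀ (n : ℕ) (x : S), (n : ℝ≥0∞) * ε ≤ Φ x + n * ε * hitBy K B n x := by
      intro n
      induction n with
      | zero => simp
      | succ n ih =>
        intro x
        by_cases hx : x ∈ B
        · rw [hitBy_of_mem hx, mul_one]
          exact le_add_self
        · have h1 : (n : ℝ≥0∞) * ε ≤ expect (K x) Φ + n * ε * hitBy K B (n + 1) x := by
            rw [hitBy_succ_of_notMem hx, ← expect_const_mul, ← expect_add]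
            exact le_expect_of_forall _ ih
          calc ((n + 1 : ℕ) : ℝ≥0∞) * ε = n * ε + ε := by push_cast; ring
            _ ≤ expect (K x) Φ + n * ε * hitBy K B (n + 1) x + ε := by gcongr
            _ = (expect (K x) Φ + ε) + n * ε * hitBy K B (n + 1) x := by ring
            _ ≤ Φ x + ((n + 1 : ℕ) : ℝ≥0∞) * ε * hitBy K B (n + 1) x := by
              gcongr
              · exact hdrift x hx
              · omega
    intro n x
    exact (aux n x).trans (by gcongr; exact hitBy_le_hit n x)
  by_contra hne
  have hlt : hit K B x < 1 := lt_of_le_of_ne (hit_le_one x) hne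
  have hgap : ε * (1 - hit K B x) ≠ 0 := mul_ne_zero hε (tsub_pos_of_lt hlt).ne'
  obtain ⟨n, hn⟩ := ENNReal.exists_nat_mul_gt hgap (hΦ x)
  have hb := key n x
  have hfin : (n : ℝ≥0∞) * ε * hit K B x ≠ ∞ :=
    ENNReal.mul_ne_top (ENNReal.mul_ne_top (ENNReal.natCast_ne_top n) hε')
      (ne_top_of_lt hlt)
  have : (n : ℝ≥0∞) * (ε * (1 - hit K B x)) ≤ Φ x := by
    have h2 : (n : ℝ≥0∞) * (ε * (1 - hit K B x)) = n * ε - n * ε * hit K B x := by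
      rw [← mul_assoc, ENNReal.mul_sub, mul_one]
      intro _ _
      exact ENNReal.mul_ne_top (ENNReal.natCast_ne_top n) hε'
    rw [h2]
    exact tsub_le_iff_right.2 hb
  exact absurd this (not_le.2 hn)

/-- In an irreducible chain with negative drift outside a finite set, every nonempty set is hit
almost surely. -/
theorem hit_eq_one_of_irreducible {Φ : S → ℝ≥0∞} {ε : ℝ≥0∞} (hε : ε ≠ 0) (hε' : ε ≠ ∞)
    (hΦ : ∀ x, Φ x ≠ ∞) {F : Set S} (hF : F.Finite)
    (hdrift : ∀ x, x ∉ F → expect (K x) Φ + ε ≤ Φ x)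
    (hirr : ∀ x y : S, Relation.ReflTransGen (fun u v => K u v ≠ 0) x y)
    (hB : B.Nonempty) (x : S) : hit K B x = 1 := by
  obtain ⟨b, hb⟩ := hB
  have hpos : ∀ x, hit K B x ≠ 0 := fun x => hit_pos_of_reflTransGen (hirr x b) hb
  obtain ⟨c, hc0, hc⟩ : ∃ c : ℝ≥0∞, c ≠ 0 ∧ ∀ x ∈ F, c ≤ hit K B x := by
    rcases F.eq_empty_or_nonempty with rfl | hne
    · exact ⟨1, one_ne_zero, by simp⟩
    · obtain ⟨m, _, hm⟩ := Set.exists_min_image F (hit K B) hF hne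
      exact ⟨_, hpos m, hm⟩
  refine hit_eq_one_of_le hc0 (fun x => ?_) x
  have := mul_hit_le_hit hc x
  rwa [hit_eq_one_of_drift hε hε' hΦ hdrift, mul_one] at this

end Hitting

/-! ### Markov chains with a countable state space -/

section Path

variable {S Ω : Type*} [Countable S] [MeasurableSpace S] [MeasurableSingletonClass S]
  [MeasurableSpace Ω] {P : Measure Ω} {X : ℕ → Ω → S} {K : S → PMF S} {B : Set S}

/-- The Markov property in the only form that `htr` provides: conditioning on a full trajectory up
to time `t`. First-step analysis then matches the recursion of `hitBy`. -/
theorem measure_cylinder_inter_hit (hX : ∀ t, Measurable (X t))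
    (htr : ∀ (t : ℕ) (x : ℕ → S),
      P {ω | ∀ i ≤ t + 1, X i ω = x i} = P {ω | ∀ i ≤ t, X i ω = x i} * K (x t) (x (t + 1)))
    (n t : ℕ) (x : ℕ → S) :
    P {ω | (∀ i ≤ t, X i ω = x i) ∧ ∃ i ≤ n, X (t + i) ω ∈ B} =
      P {ω | ∀ i ≤ t, X i ω = x i} * hitBy K B n (x t) := by
  classical
  induction n generalizing t x with
  | zero =>
    by_cases hx : x t ∈ B
    · rw [hitBy_of_mem hx, mul_one]
      congr 1
      ext ω
      simp only [Set.mem_ofPred_eq, and_iff_left_iff_imp]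
      exact fun h => ⟨0, le_rfl, by simpa [h t le_rfl] using hx⟩
    · rw [hitBy_zero_of_notMem hx, mul_zero]
      convert measure_empty (μ := P)
      ext ω
      simp only [Set.mem_ofPred_eq, Set.mem_empty_iff_false, iff_false, not_and]
      rintro h ⟨i, hi, hB⟩
      obtain rfl : i = 0 := by omega
      exact hx (by simpa [h t le_rfl] using hB)
  | succ n ih =>
    by_cases hx : x t ∈ B
    · rw [hitBy_of_mem hx, mul_one]
      congr 1
      ext ω
      simp only [Set.mem_ofPred_eq, and_iff_left_iff_imp]
      exact fun h => ⟨0, by omega, by simpa [h t le_rfl] using hx⟩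
    · rw [hitBy_succ_of_notMem hx]
      -- Prolong the prescribed trajectory by `y` at time `t + 1`; the event is split according to
      -- the next state.
      let e : S → ℕ → S := fun y => Function.update x (t + 1) y
      have he : ∀ y i, i ≤ t → e y i = x i := fun y i hi =>
        Function.update_of_ne (by omega) _ _
      have he' : ∀ y, e y (t + 1) = y := fun y => Function.update_self _ _ _
      have hcyl : ∀ y ω, (∀ i ≤ t + 1, X i ω = e y i) ↔
          ((∀ i ≤ t, X i ω = x i) ∧ X (t + 1) ω = y) := by
        intro y ω
        constructor
        · intro h
          exact ⟨fun i hi => (h i (by omega)).trans (he y i hi),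
            (h (t + 1) le_rfl).trans (he' y)⟩
        · rintro ⟨h, h'⟩ i hi
          rcases Nat.lt_or_ge t i with hti | hti
          · obtain rfl : i = t + 1 := by omega
            rw [h', he']
          · rw [h i hti, he y i hti]
      have hcylt : ∀ y, {ω | ∀ i ≤ t, X i ω = e y i} = {ω | ∀ i ≤ t, X i ω = x i} := by
        intro y
        ext ω
        exact forall₂_congr fun i hi => by rw [he y i hi]
      have hset : {ω | (∀ i ≤ t, X i ω = x i) ∧ ∃ i ≤ n + 1, X (t + i) ω ∈ B} =
          ⋃ y, {ω | (∀ i ≤ t + 1, X i ω = e y i) ∧ ∃ i ≤ n, X (t + 1 + i) ω ∈ B} := by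
        ext ω
        simp only [Set.mem_iUnion, Set.mem_ofPred_eq, hcyl]
        constructor
        · rintro ⟨h, i, hi, hB⟩
          refine ⟨X (t + 1) ω, ⟨h, rfl⟩, ?_⟩
          cases i with
          | zero => exact absurd (by simpa [h t le_rfl] using hB) hx
          | succ j => exact ⟨j, by omega, by rwa [show t + 1 + j = t + (j + 1) by omega]⟩
        · rintro ⟨y, ⟨h, -⟩, i, hi, hB⟩
          exact ⟨h, i + 1, by omega, by rwa [show t + (i + 1) = t + 1 + i by omega]⟩
      rw [hset, measure_iUnion]
      · rw [expect, ← ENNReal.tsum_mul_left]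
        refine tsum_congr fun y => ?_
        rw [ih (t + 1) (e y), htr, hcylt, he', he y t le_rfl]
        ring
      · intro y z hyz
        refine Set.disjoint_left.2 fun ω hy hz => hyz ?_
        rw [← ((hcyl y ω).1 hy.1).2, ← ((hcyl z ω).1 hz.1).2]
      · intro y
        have h1 : MeasurableSet {ω | ∀ i ≤ t + 1, X i ω = e y i} := by
          simp only [Set.ofPred_forall]
          exact MeasurableSet.iInter fun i => MeasurableSet.iInter fun _ =>
            hX i (measurableSet_singleton _)
        have h2 : MeasurableSet {ω | ∃ i ≤ n, X (t + 1 + i) ω ∈ B} := by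
          simp only [Set.ofPred_exists, Set.ofPred_and]
          exact MeasurableSet.iUnion fun i => (MeasurableSet.const _).inter
            (hX _ (Set.to_countable B).measurableSet)
        exact h1.inter h2

/-- The probability that a Markov chain ever visits `B` is the average of the hitting
probabilities over the initial law. -/
theorem measure_exists_mem_eq (hX : ∀ t, Measurable (X t)) {ν : PMF S}
    (hinit : ∀ s, P {ω | X 0 ω = s} = ν s)
    (htr : ∀ (t : ℕ) (x : ℕ → S),
      P {ω | ∀ i ≤ t + 1, X i ω = x i} = P {ω | ∀ i ≤ t, X i ω = x i} * K (x t) (x (t + 1))) :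
    P {ω | ∃ t, X t ω ∈ B} = expect ν (hit K B) := by
  have hmeas : ∀ n, MeasurableSet {ω | ∃ i ≤ n, X i ω ∈ B} := fun n => by
    simp only [Set.ofPred_exists, Set.ofPred_and]
    exact MeasurableSet.iUnion fun i => (MeasurableSet.const _).inter
      (hX _ (Set.to_countable B).measurableSet)
  have hfin : ∀ n, P {ω | ∃ i ≤ n, X i ω ∈ B} = expect ν (hitBy K B n) := by
    intro n
    have hset : {ω | ∃ i ≤ n, X i ω ∈ B} =
        ⋃ y, {ω | (∀ i ≤ 0, X i ω = (fun _ => y) i) ∧ ∃ i ≤ n, X (0 + i) ω ∈ B} := by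
      ext ω
      simp
    rw [hset, measure_iUnion]
    · refine tsum_congr fun y => ?_
      rw [measure_cylinder_inter_hit hX htr n 0 fun _ => y, ← hinit y]
      simp
    · intro y z hyz
      refine Set.disjoint_left.2 fun ω hy hz => hyz ?_
      exact (hy.1 0 le_rfl).symm.trans (hz.1 0 le_rfl)
    · intro y
      have h1 : MeasurableSet {ω | ∀ i ≤ 0, X i ω = (fun _ => y) i} := by
        simp only [Set.ofPred_forall]
        exact MeasurableSet.iInter fun i => MeasurableSet.iInter fun _ =>
          hX i (measurableSet_singleton _)
      have h2 : MeasurableSet {ω | ∃ i ≤ n, X (0 + i) ω ∈ B} := by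
        simpa only [zero_add] using hmeas n
      exact h1.inter h2
  have hunion : {ω | ∃ t, X t ω ∈ B} = ⋃ n, {ω | ∃ i ≤ n, X i ω ∈ B} := by
    ext ω
    simp only [Set.mem_ofPred_eq, Set.mem_iUnion]
    exact ⟨fun ⟨t, h⟩ => ⟨t, t, le_rfl, h⟩, fun ⟨_, t, _, h⟩ => ⟨t, h⟩⟩
  rw [hunion, Monotone.measure_iUnion]
  · simp only [hfin]
    exact (expect_iSup ν hitBy_mono).symm
  · intro m n hmn ω ⟨i, hi, h⟩
    exact ⟨i, hi.trans hmn, h⟩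

end Path


section

variable {D : ℕ} {A : Type*}

/-! ### One step of the algorithm -/

theorem expect_chainStep {S : Type*} (p : S → A → PMF S) (σ : S → PMF A) (x : S)
    (f : S → ℝ≥0∞) :
    expect (chainStep p σ x) f = expect (σ x) fun a => expect (p x a) f :=
  expect_bind _ _ _

theorem expect_coin (x : ℝ) (hx : x ≤ 1) (f : Bool → ℝ≥0∞) :
    expect (coin x hx) f = ENNReal.ofReal x * f true + (1 - ENNReal.ofReal x) * f false := by
  simp [expect, coin, tsum_fintype]

theorem clip_emb {U : ℕ} (q : TState D U) : clip U (emb q) = q := by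
  funext i
  ext
  simp only [clip, emb]
  have := (q i).isLt
  omega

theorem emb_mem_truncSet {U : ℕ} (q : TState D U) : emb q ∈ truncSet D U :=
  fun i => Nat.lt_succ_iff.1 (q i).isLt

theorem mem_truncSet_and_eq_clip_iff {U : ℕ} {Q : Backlog D} {q : TState D U} :
    (Q ∈ truncSet D U ∧ q = clip U Q) ↔ Q = emb q := by
  constructor
  · rintro ⟨h, rfl⟩
    funext i
    simp only [emb, clip]
    have := h i
    omega
  · rintro rfl
    exact ⟨emb_mem_truncSet q, (clip_emb q).symm⟩

section

variable [Fintype A] [Nonempty A] (R : Setup D A)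

/-- The state after a time slot in which the current episode goes on. -/
def Setup.continued (s : RunState D R.U A) (a : A) (Q' : Backlog D) : RunState D R.U A :=
  ⟨Q', R.newCounts s a Q', s.episode, R.newVisits s, s.plan⟩

theorem Setup.expect_step (s : RunState D R.U A) (f : RunState D R.U A → ℝ≥0∞) :
    expect (R.step s) f =
      expect (R.action s) fun a => expect (R.M.p s.Q a) fun Q' => expect (R.update s a Q') f := by
  simp only [Setup.step, expect_bind]

theorem Setup.expect_update_continued {s : RunState D R.U A}
    (h : (R.newVisits s : ℝ) < R.L * √s.episode) (a : A) (Q' : Backlog D)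
    (f : RunState D R.U A → ℝ≥0∞) :
    expect (R.update s a Q') f = f (R.continued s a Q') := by
  simp [Setup.update, h, expect_pure, Setup.continued]

theorem Setup.expect_drawPlan (k : ℕ) (c : Counts D R.U A)
    (f : Option (TState D R.U → A) → ℝ≥0∞) :
    expect (R.drawPlan k c) f = ENNReal.ofReal (R.exploreProb k) * f none +
      (1 - ENNReal.ofReal (R.exploreProb k)) * f (some (R.solve (R.estimate c))) := by
  simp [Setup.drawPlan, expect_map, expect_coin]

theorem Setup.expect_update_next {s : RunState D R.U A}
    (h : ¬ (R.newVisits s : ℝ) < R.L * √s.episode) (a : A) (Q' : Backlog D)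
    (f : RunState D R.U A → ℝ≥0∞) :
    expect (R.update s a Q') f = expect (R.drawPlan (s.episode + 1) (R.newCounts s a Q'))
      fun m => f ⟨Q', R.newCounts s a Q', s.episode + 1, 0, m⟩ := by
  simp [Setup.update, h, expect_map]

theorem Setup.expect_step_le {s : RunState D R.U A} {f : RunState D R.U A → ℝ≥0∞} {c : ℝ≥0∞}
    (h1 : (R.newVisits s : ℝ) < R.L * √s.episode → ∀ a Q', f (R.continued s a Q') ≤ c)
    (h2 : ¬ (R.newVisits s : ℝ) < R.L * √s.episode → ∀ a Q',
      expect (R.drawPlan (s.episode + 1) (R.newCounts s a Q'))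
        (fun m => f ⟨Q', R.newCounts s a Q', s.episode + 1, 0, m⟩) ≤ c) :
    expect (R.step s) f ≤ c := by
  rw [R.expect_step]
  refine expect_le_of_forall _ fun a => expect_le_of_forall _ fun Q' => ?_
  by_cases h : (R.newVisits s : ℝ) < R.L * √s.episode
  · rw [R.expect_update_continued h]
    exact h1 h a Q'
  · rw [R.expect_update_next h]
    exact h2 h a Q'

theorem Setup.le_expect_step {s : RunState D R.U A} {f : RunState D R.U A → ℝ≥0∞} {c : ℝ≥0∞}
    (h1 : (R.newVisits s : ℝ) < R.L * √s.episode → ∀ a Q', c ≤ f (R.continued s a Q'))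
    (h2 : ¬ (R.newVisits s : ℝ) < R.L * √s.episode → ∀ a Q',
      c ≤ expect (R.drawPlan (s.episode + 1) (R.newCounts s a Q'))
        (fun m => f ⟨Q', R.newCounts s a Q', s.episode + 1, 0, m⟩)) :
    c ≤ expect (R.step s) f := by
  rw [R.expect_step]
  refine le_expect_of_forall _ fun a => le_expect_of_forall _ fun Q' => ?_
  by_cases h : (R.newVisits s : ℝ) < R.L * √s.episode
  · rw [R.expect_update_continued h]
    exact h1 h a Q'
  · rw [R.expect_update_next h]
    exact h2 h a Q'

theorem Setup.newVisits_le (s : RunState D R.U A) : R.newVisits s ≤ s.inVisits + 1 := by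
  unfold Setup.newVisits
  split_ifs <;> omega

theorem Setup.le_newVisits (s : RunState D R.U A) : s.inVisits ≤ R.newVisits s := by
  unfold Setup.newVisits
  split_ifs <;> omega

open Classical in
theorem Setup.newCounts_apply (s : RunState D R.U A) (a : A) (Q' : Backlog D)
    (q : TState D R.U) (b : A) (q' : TState D R.U) :
    R.newCounts s a Q' q b q' =
      s.counts q b q' + if s.Q = emb q ∧ a = b ∧ clip R.U Q' = q' then 1 else 0 := by
  have h : (s.Q ∈ truncSet D R.U ∧ q = clip R.U s.Q ∧ b = a ∧ q' = clip R.U Q') ↔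
      (s.Q = emb q ∧ a = b ∧ clip R.U Q' = q') := by
    rw [← and_assoc, mem_truncSet_and_eq_clip_iff, eq_comm (a := b), eq_comm (a := q')]
  simp only [Setup.newCounts, h]
  split_ifs <;> rfl

open Classical in
theorem Setup.visits_newCounts (s : RunState D R.U A) (a : A) (Q' : Backlog D)
    (q : TState D R.U) (b : A) :
    visits (R.newCounts s a Q') q b =
      visits s.counts q b + if s.Q = emb q ∧ a = b then 1 else 0 := by
  simp only [visits, R.newCounts_apply, Finset.sum_add_distrib, ← and_assoc]
  by_cases h : s.Q = emb q ∧ a = b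
  · simp [h]
  · simp [h]

theorem Setup.visits_le_visits_newCounts (s : RunState D R.U A) (a : A) (Q' : Backlog D)
    (q : TState D R.U) (b : A) : visits s.counts q b ≤ visits (R.newCounts s a Q') q b := by
  rw [R.visits_newCounts]
  exact Nat.le_add_right _ _

variable {R}

/-- Comparison of a superharmonic function of the run with a hitting probability of the backlog
process: as long as the run stays in the classes `I n`, it follows the policy `σ`. -/
theorem Setup.mul_hitBy_le {σ : Backlog D → PMF A} {B : Set (Backlog D)} {c : ℝ≥0∞}
    {G : RunState D R.U A → ℝ≥0∞} (hG : ∀ s, expect (R.step s) G ≤ G s)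
    (I : ℕ → Set (RunState D R.U A)) (hB : ∀ n, ∀ s ∈ I n, s.Q ∈ B → c ≤ G s)
    (hI : ∀ n, ∀ s ∈ I (n + 1), s.Q ∉ B → R.action s = σ s.Q ∧
      (R.newVisits s : ℝ) < R.L * √s.episode ∧
      ∀ a Q', R.continued s a Q' ∈ I n ∨ c ≤ G (R.continued s a Q'))
    (n : ℕ) (s : RunState D R.U A) (hs : s ∈ I n) :
    c * hitBy (chainStep R.M.p σ) B n s.Q ≤ G s := by
  induction n generalizing s with
  | zero =>
    by_cases hQ : s.Q ∈ B
    · simpa [hitBy_of_mem hQ] using hB 0 s hs hQ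
    · simp [hitBy_zero_of_notMem hQ]
  | succ n ih =>
    by_cases hQ : s.Q ∈ B
    · simpa [hitBy_of_mem hQ] using hB _ s hs hQ
    · obtain ⟨hact, hv, hnext⟩ := hI n s hs hQ
      refine le_trans ?_ (hG s)
      rw [hitBy_succ_of_notMem hQ, expect_chainStep, ← expect_const_mul, R.expect_step, hact]
      refine expect_mono _ fun a => ?_
      rw [← expect_const_mul]
      refine expect_mono _ fun Q' => ?_
      rw [R.expect_update_continued hv]
      rcases hnext a Q' with h | h
      · exact ih _ h
      · exact le_trans (mul_le_of_le_one_right' (hitBy_le_one _ _)) h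

/-- The version without a time limit, for a class that does not depend on the number of remaining
steps. The indexed version is needed when a budget of visits shrinks with each step. -/
theorem Setup.mul_hit_le {σ : Backlog D → PMF A} {B : Set (Backlog D)} {c : ℝ≥0∞}
    {G : RunState D R.U A → ℝ≥0∞} (hG : ∀ s, expect (R.step s) G ≤ G s)
    (I : Set (RunState D R.U A)) (hB : ∀ s ∈ I, s.Q ∈ B → c ≤ G s)
    (hI : ∀ s ∈ I, s.Q ∉ B → R.action s = σ s.Q ∧
      (R.newVisits s : ℝ) < R.L * √s.episode ∧
      ∀ a Q', R.continued s a Q' ∈ I ∨ c ≤ G (R.continued s a Q'))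
    (s : RunState D R.U A) (hs : s ∈ I) :
    c * hit (chainStep R.M.p σ) B s.Q ≤ G s := by
  rw [hit, ENNReal.mul_iSup]
  exact iSup_le fun n =>
    Setup.mul_hitBy_le hG (fun _ => I) (fun _ => hB) (fun _ => hI) n s hs

/-! ### Recurrence of the backlog process -/

theorem finite_setOf_forall_le (N : Backlog D) : {Q : Backlog D | ∀ i, Q i ≤ N i}.Finite :=
  Set.finite_Iic N

/-- Bounded jumps make the real series finitely supported, so its `tsum` is the true expectation and
not the default value `0` of a divergent series. -/
theorem QueueMDP.expect_chainStep_ofReal (M : QueueMDP D A) (σ : Backlog D → PMF A)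
    {Φ : Backlog D → ℝ} (hΦ : ∀ Q, 0 ≤ Φ Q) (Q : Backlog D) :
    expect (chainStep M.p σ Q) (fun Q' => ENNReal.ofReal (Φ Q')) =
      ENNReal.ofReal (∑' Q', (chainStep M.p σ Q Q').toReal * Φ Q') := by
  have hsupp : ∀ Q', chainStep M.p σ Q Q' ≠ 0 → ∀ i, Q' i ≤ Q i + M.W := by
    intro Q' h i
    obtain ⟨a, -, ha⟩ := (PMF.mem_support_bind_iff _ _ _).1 ((PMF.mem_support_iff _ _).2 h)
    have := M.bounded_jump Q a Q' ((PMF.mem_support_iff _ _).1 ha) i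
    rw [abs_le] at this
    omega
  have hfin : (Function.support fun Q' => (chainStep M.p σ Q Q').toReal * Φ Q').Finite :=
    (finite_setOf_forall_le (fun i => Q i + M.W)).subset fun Q' hQ' => hsupp Q' fun h0 => by
      simp [h0] at hQ'
  rw [ENNReal.ofReal_tsum_of_nonneg
    (fun Q' => mul_nonneg ENNReal.toReal_nonneg (hΦ Q')) (summable_of_hasFiniteSupport hfin)]
  refine tsum_congr fun Q' => ?_
  rw [ENNReal.ofReal_mul ENNReal.toReal_nonneg, ENNReal.ofReal_toReal (PMF.apply_ne_top _ _)]

/-- The upper bound on `Φ` vanishes at the empty backlog because `β ≠ 0`. This supplies the nonempty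
target required by the recurrence criterion. -/
theorem Setup.zero_mem_Sin (horder : R.HasOrder) : (0 : Backlog D) ∈ R.Sin := by
  obtain ⟨hβ, b₁, -, h⟩ := horder
  have h0 : qmax (emb (clip R.U (0 : Backlog D))) = 0 := by
    simp [qmax, emb, clip]
  refine ⟨fun i => Nat.zero_le _, ((h _).2).trans ?_⟩
  rw [h0, Nat.cast_zero, Real.zero_rpow (by linarith), mul_zero]
  have : (R.M.W : ℝ) < R.U := by exact_mod_cast R.W_lt_U
  exact Real.rpow_nonneg (by linarith) _

/-- Every policy that equals `π₀` outside the truncated state space and under which all states are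
accessible from each other visits `S^in` almost surely. -/
theorem Setup.hit_Sin_eq_one (hstab : IsStabilizing R.M R.π₀) (horder : R.HasOrder)
    {σ : Backlog D → PMF A} (hσ : ∀ Q, Q ∉ truncSet D R.U → σ Q = R.π₀ Q)
    (hirr : IrreducibleUnder R.M.p σ) (Q : Backlog D) :
    hit (chainStep R.M.p σ) R.Sin Q = 1 := by
  obtain ⟨Φ₀, a, α, ε₀, B₀, -, -, hε, -, hΦ, -, hdrift⟩ := hstab
  -- The finite exceptional set is a cube of side `max U ⌈B₀⌉`: outside it some queue exceeds `U`,
  -- so `σ` acts as `π₀`, and the same queue exceeds `B₀`, so the drift condition applies.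
  refine hit_eq_one_of_irreducible (Φ := fun Q => ENNReal.ofReal (Φ₀ Q))
    (ε := ENNReal.ofReal ε₀) (ENNReal.ofReal_pos.2 hε).ne' ENNReal.ofReal_ne_top
    (fun _ => ENNReal.ofReal_ne_top)
    (finite_setOf_forall_le (fun _ => max R.U ⌈B₀⌉₊)) ?_ hirr ⟨0, R.zero_mem_Sin horder⟩ Q
  intro Q hQ
  simp only [Set.mem_ofPred_eq, not_forall, not_le] at hQ
  obtain ⟨i, hi⟩ := hQ
  have hQU : Q ∉ truncSet D R.U := fun h => by
    have := h i
    omega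
  have hB : B₀ ≤ (qmax Q : ℝ) := by
    have h1 : ⌈B₀⌉₊ ≤ qmax Q :=
      (by omega : ⌈B₀⌉₊ ≤ Q i).trans (Finset.le_sup (f := Q) (Finset.mem_univ i))
    exact (Nat.le_ceil B₀).trans (by exact_mod_cast h1)
  have hchain : chainStep R.M.p σ Q = chainStep R.M.p R.π₀ Q := by
    simp only [chainStep, hσ Q hQU]
  rw [hchain, R.M.expect_chainStep_ofReal R.π₀ hΦ, ← ENNReal.ofReal_add _ hε.le]
  · exact ENNReal.ofReal_le_ofReal (by linarith [hdrift Q hB])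
  · exact tsum_nonneg fun Q' => mul_nonneg ENNReal.toReal_nonneg (hΦ Q')

theorem Setup.explorePolicy_of_notMem {Q : Backlog D} (hQ : Q ∉ truncSet D R.U) :
    R.explorePolicy Q = R.π₀ Q := by
  simp [Setup.explorePolicy, hQ]

theorem Setup.exploitPolicy_of_notMem (π : TState D R.U → A) {Q : Backlog D} (hQ : Q ∉ R.Sin) :
    R.exploitPolicy π Q = R.π₀ Q := by
  simp [Setup.exploitPolicy, hQ]

theorem Setup.hit_Sin_explore (hstab : IsStabilizing R.M R.π₀) (horder : R.HasOrder)
    (hirr : IrreducibleUnder R.M.p R.explorePolicy) (Q : Backlog D) :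
    hit (chainStep R.M.p R.explorePolicy) R.Sin Q = 1 :=
  Setup.hit_Sin_eq_one hstab horder (fun _ => Setup.explorePolicy_of_notMem) hirr Q

/-- Outside `S^in` all exploitation policies agree, so it suffices that one of them makes the
backlog process irreducible. -/
theorem Setup.hit_Sin_exploit (hstab : IsStabilizing R.M R.π₀) (horder : R.HasOrder)
    {πopt : TState D R.U → A} (hirr : IrreducibleUnder R.M.p (R.exploitPolicy πopt))
    (π : TState D R.U → A) (Q : Backlog D) :
    hit (chainStep R.M.p (R.exploitPolicy π)) R.Sin Q = 1 := by
  rw [← Setup.hit_Sin_eq_one hstab horder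
    (fun Q hQ => R.exploitPolicy_of_notMem πopt fun h => hQ h.1) hirr Q]
  refine hit_congr (fun Q hQ => ?_) Q
  simp only [chainStep, Setup.exploitPolicy_of_notMem _ hQ]

/-! ### All episodes are reached -/

theorem Setup.newVisits_of_notMem {s : RunState D R.U A} (h : s.Q ∉ R.Sin) :
    R.newVisits s = s.inVisits := by
  simp [Setup.newVisits, h]

theorem Setup.newVisits_of_mem {s : RunState D R.U A} (h : s.Q ∈ R.Sin) :
    R.newVisits s = s.inVisits + 1 := by
  simp [Setup.newVisits, h]

/-- The policy that is followed in an episode with the given plan. -/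
def Setup.planPolicy (R : Setup D A) (m : Option (TState D R.U → A)) : Backlog D → PMF A :=
  match m with
  | none => R.explorePolicy
  | some π => R.exploitPolicy π

theorem Setup.action_eq (s : RunState D R.U A) : R.action s = R.planPolicy s.plan s.Q := by
  unfold Setup.action Setup.planPolicy
  split <;> simp_all

/-- Between visits to `S^in` the visit counter is frozen and the plan's policy is followed, so
`hrec` yields the next visit almost surely. Finitely many visits exhaust the quota `L * √k`. -/
theorem Setup.hit_next_episode
    (hrec : ∀ m Q, hit (chainStep R.M.p (R.planPolicy m)) R.Sin Q = 1)
    (s : RunState D R.U A) : hit R.step {y | y.episode = s.episode + 1} s = 1 := by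
  obtain ⟨k, hk⟩ : ∃ k, s.episode = k := ⟨_, rfl⟩
  -- The induction variable bounds the number of visits still missing in this episode.
  obtain ⟨j, hj⟩ := exists_nat_gt (R.L * √(k : ℝ))
  have hj' : R.L * √(k : ℝ) ≤ s.inVisits + j := by
    have : (0 : ℝ) ≤ s.inVisits := Nat.cast_nonneg _
    linarith
  rw [hk]
  clear hj
  induction j generalizing s with
  | zero =>
    refine le_antisymm (hit_le_one s) (le_trans ?_ (expect_hit_le s))
    have hend : ¬ (R.newVisits s : ℝ) < R.L * √s.episode := by
      have : (s.inVisits : ℝ) ≤ R.newVisits s := by exact_mod_cast R.le_newVisits s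
      simp only [hk, not_lt]
      push_cast at hj'
      linarith
    refine R.le_expect_step (fun h => absurd h hend) fun _ a Q' => ?_
    refine le_expect_of_forall _ fun m => ?_
    rw [hit_of_mem]
    simp [hk]
  | succ j ih =>
    set G := hit R.step {y : RunState D R.U A | y.episode = k + 1} 
    refine le_antisymm (hit_le_one s) ?_
    have h1 : 1 * hit (chainStep R.M.p (R.planPolicy s.plan)) R.Sin s.Q = 1 := by
      rw [hrec, one_mul]
    rw [← h1]
    by_cases hlt : (s.inVisits : ℝ) < R.L * √(k : ℝ)
    · refine Setup.mul_hit_le (G := G) (fun s => expect_hit_le s)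
        {y | y.episode = k ∧ y.plan = s.plan ∧ y.inVisits = s.inVisits} ?_ ?_ s ⟨hk, rfl, rfl⟩
      · rintro y ⟨hyk, -, hyv⟩ hyQ
        refine le_trans ?_ (expect_hit_le y)
        refine R.le_expect_step (fun _ a Q' => ?_) fun _ a Q' => ?_
        · refine (ih (R.continued y a Q') hyk ?_).ge
          simp only [Setup.continued, Setup.newVisits_of_mem hyQ, hyv]
          push_cast at hj' ⊢
          linarith
        · refine le_expect_of_forall _ fun m => ?_
          rw [hit_of_mem]
          simp [hyk]
      · rintro y ⟨hyk, hyp, hyv⟩ hyQ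
        refine ⟨by rw [Setup.action_eq, hyp], ?_, fun a Q' => Or.inl ⟨hyk, hyp, ?_⟩⟩
        · rwa [Setup.newVisits_of_notMem hyQ, hyv, hyk]
        · exact (Setup.newVisits_of_notMem hyQ).trans hyv
    -- An arbitrary state may already have exhausted the quota; then the bound for `j` holds as
    -- well.
    · rw [h1]
      refine (ih s hk ?_).ge
      have : (0 : ℝ) ≤ j := Nat.cast_nonneg _
      linarith [not_lt.1 hlt]

theorem Setup.hit_episode
    (hrec : ∀ m Q, hit (chainStep R.M.p (R.planPolicy m)) R.Sin Q = 1)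
    {k : ℕ} (s : RunState D R.U A) (hs : s.episode ≤ k) :
    hit R.step {y | y.episode = k} s = 1 := by
  obtain ⟨j, hj⟩ := Nat.exists_eq_add_of_le hs
  clear hs
  induction j generalizing s with
  | zero => exact hit_of_mem hj.symm
  | succ j ih =>
    refine le_antisymm (hit_le_one s) ?_
    have h := mul_hit_le_hit (K := R.step) (B := {y | y.episode = s.episode + 1})
      (C := {y | y.episode = k}) (c := 1)
      (fun y hy => (ih y (by rw [hj, show y.episode = s.episode + 1 from hy]; omega)).ge) s
    rwa [one_mul, Setup.hit_next_episode hrec] at h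

/-! ### Exploration -/

/-- Finiteness of `S^in` gives one horizon `n` and one bound `c` for all starting points. A fixed
horizon is needed because an episode only leaves room for limitedly many visits. -/
theorem Setup.exists_le_hitBy_of_irreducible
    (hirr : IrreducibleUnder R.M.p R.explorePolicy) (Q₀ : Backlog D) :
    ∃ n, ∃ c : ℝ≥0∞, c ≠ 0 ∧ c ≤ 1 ∧
      ∀ Q ∈ R.Sin, c ≤ hitBy (chainStep R.M.p R.explorePolicy) {Q₀} n Q := by
  have hfin : R.Sin.Finite :=
    (finite_setOf_forall_le (fun _ => R.U)).subset fun Q hQ => hQ.1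
  have hpos : ∀ Q, ∃ n, hitBy (chainStep R.M.p R.explorePolicy) {Q₀} n Q ≠ 0 := by
    intro Q
    by_contra! h
    exact hit_pos_of_reflTransGen (hirr Q Q₀) (Set.mem_singleton Q₀) (by simp [hit, h])
  choose N hN using hpos
  let n := hfin.toFinset.sup N
  have hn : ∀ Q ∈ R.Sin, hitBy (chainStep R.M.p R.explorePolicy) {Q₀} n Q ≠ 0 := by
    intro Q hQ h0
    have h1 : N Q ≤ n := Finset.le_sup (f := N) (hfin.mem_toFinset.2 hQ)
    have h2 := hitBy_mono (K := chainStep R.M.p R.explorePolicy) (B := {Q₀}) h1 Q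
    exact hN Q (le_antisymm (h2.trans h0.le) zero_le)
  rcases R.Sin.eq_empty_or_nonempty with he | hne
  · exact ⟨n, 1, one_ne_zero, le_rfl, by simp [he]⟩
  · obtain ⟨m, hm, hmin⟩ := Set.exists_min_image R.Sin
      (hitBy (chainStep R.M.p R.explorePolicy) {Q₀} n) hfin hne
    exact ⟨n, _, hn m hm, hitBy_le_one _ _, hmin⟩

/-- The states in episode `k` at which the pair `(q, a)` has been recorded more than `m` times. -/
def Setup.recordSet (R : Setup D A) (q : TState D R.U) (a : A) (k m : ℕ) :
    Set (RunState D R.U A) :=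
  {y | y.episode = k ∧ m < visits y.counts q a}

theorem inv_card_le_one : (Fintype.card A : ℝ≥0∞)⁻¹ ≤ 1 :=
  ENNReal.inv_le_one.2 (by exact_mod_cast Nat.succ_le_of_lt (Fintype.card_pos (α := A)))

/-- Each slot adds at most one visit, so the slack `n + 1` keeps the episode alive for the `n` steps
towards `q` and for the slot that records the pair. There the uniform choice picks `a` with
probability `1 / |A|`. -/
theorem Setup.inv_card_mul_hitBy_le (q : TState D R.U) (a : A) (k m n : ℕ)
    (s : RunState D R.U A) (hk : s.episode = k) (hp : s.plan = none)
    (hv : (s.inVisits : ℝ) + n + 1 < R.L * √(k : ℝ)) (hm : visits s.counts q a = m) :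
    (Fintype.card A : ℝ≥0∞)⁻¹ * hitBy (chainStep R.M.p R.explorePolicy) {emb q} n s.Q ≤
      hit R.step (R.recordSet q a k m) s := by
  refine Setup.mul_hitBy_le (fun s => expect_hit_le s)
    (fun n => {y | y.episode = k ∧ y.plan = none ∧ (y.inVisits : ℝ) + n + 1 < R.L * √(k : ℝ) ∧
      visits y.counts q a = m}) ?_ ?_ n s ⟨hk, hp, hv, hm⟩
  · rintro n y ⟨hyk, hyp, hyv, hym⟩ (hyQ : y.Q = emb q)
    refine le_trans ?_ (expect_hit_le y)
    have hcont : (R.newVisits y : ℝ) < R.L * √y.episode := by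
      have h1 : (R.newVisits y : ℝ) ≤ y.inVisits + 1 := by exact_mod_cast R.newVisits_le y
      have h2 : (0 : ℝ) ≤ n := Nat.cast_nonneg _
      rw [hyk]
      linarith
    have hact : R.action y a = (Fintype.card A : ℝ≥0∞)⁻¹ := by
      rw [Setup.action_eq, hyp, hyQ]
      simp [Setup.planPolicy, Setup.explorePolicy, emb_mem_truncSet]
    rw [R.expect_step, ← hact]
    refine le_trans ?_ (mul_le_expect _ _ a)
    refine le_mul_of_one_le_right' (le_expect_of_forall _ fun Q' => ?_)
    rw [R.expect_update_continued hcont, hit_of_mem]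
    refine ⟨hyk, ?_⟩
    simp only [Setup.continued, R.visits_newCounts, hyQ, hym]
    simp
  · rintro n y ⟨hyk, hyp, hyv, hym⟩ -
    have h1 : (R.newVisits y : ℝ) ≤ y.inVisits + 1 := by exact_mod_cast R.newVisits_le y
    push_cast at hyv
    refine ⟨by rw [Setup.action_eq, hyp]; rfl, ?_, fun b Q' => ?_⟩
    · have h2 : (0 : ℝ) ≤ n := Nat.cast_nonneg _
      rw [hyk]
      linarith
    · rcases (R.visits_le_visits_newCounts y b Q' q a).eq_or_lt with h | h
      · refine Or.inl ⟨hyk, hyp, ?_, h.symm.trans hym⟩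
        simp only [Setup.continued]
        linarith
      · refine Or.inr ?_
        rw [hit_of_mem]
        · exact inv_card_le_one
        · exact ⟨hyk, hym ▸ h⟩

/-- Late exploration episodes record every state-action pair with probability bounded away from
zero. -/
theorem Setup.exists_le_hit_recordSet
    (hrec : ∀ Q, hit (chainStep R.M.p R.explorePolicy) R.Sin Q = 1)
    (hirr : IrreducibleUnder R.M.p R.explorePolicy) (q : TState D R.U) (a : A) :
    ∃ η : ℝ≥0∞, η ≠ 0 ∧ ∃ K : ℕ, ∀ k ≥ K, ∀ s : RunState D R.U A, s.episode = k →
      s.plan = none → s.inVisits = 0 →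
      η ≤ hit R.step (R.recordSet q a k (visits s.counts q a)) s := by
  obtain ⟨n, c, hc, hc1, hn⟩ := Setup.exists_le_hitBy_of_irreducible hirr (emb q)
  refine ⟨(Fintype.card A : ℝ≥0∞)⁻¹ * c,
    mul_ne_zero (ENNReal.inv_ne_zero.2 (ENNReal.natCast_ne_top _)) hc, ?_⟩
  have hlim : Tendsto (fun k : ℕ => R.L * √(k : ℝ)) atTop atTop :=
    (Real.tendsto_sqrt_atTop.comp tendsto_natCast_atTop_atTop).const_mul_atTop R.L_pos
  -- From episode `K` on, the quota leaves room for the `n` steps and the recording slot. The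
  -- initial trip to `S^in` uses up none of it.
  obtain ⟨K, hK⟩ := eventually_atTop.1 (hlim.eventually_gt_atTop ((n : ℝ) + 1))
  refine ⟨K, fun k hk s hs hp hv => ?_⟩
  have hLk := hK k hk
  rw [← mul_one (_ * c), ← hrec s.Q]
  refine Setup.mul_hit_le (fun s => expect_hit_le s)
    {y | y.episode = k ∧ y.plan = none ∧ y.inVisits = 0 ∧
      visits y.counts q a = visits s.counts q a} ?_ ?_ s ⟨hs, hp, hv, rfl⟩
  · rintro y ⟨hyk, hyp, hyv, hym⟩ hyQ
    refine le_trans ?_ (Setup.inv_card_mul_hitBy_le q a k _ n y hyk hyp ?_ hym)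
    · gcongr
      exact hn _ hyQ
    · rw [hyv]
      push_cast
      linarith
  · rintro y ⟨hyk, hyp, hyv, hym⟩ hyQ
    refine ⟨by rw [Setup.action_eq, hyp]; rfl, ?_, fun b Q' => ?_⟩
    · rw [Setup.newVisits_of_notMem hyQ, hyv, hyk]
      have h2 : (0 : ℝ) ≤ n := Nat.cast_nonneg _
      push_cast
      linarith
    · rcases (R.visits_le_visits_newCounts y b Q' q a).eq_or_lt with h | h
      · exact Or.inl ⟨hyk, hyp, (Setup.newVisits_of_notMem hyQ).trans hyv, h.symm.trans hym⟩
      · refine Or.inr ?_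
        have hmem : R.continued y b Q' ∈ R.recordSet q a k (visits s.counts q a) :=
          ⟨hyk, hym ▸ h⟩
        rw [hit_of_mem hmem]
        exact mul_le_one' inv_card_le_one hc1

end

end


section

variable {D : ℕ} {A : Type*} [Fintype A] [Nonempty A] {R : Setup D A}

/-! ### Every pair is recorded often -/

/-- The states in episode `k` at which the pair `(q, a)` has been recorded fewer than `n₀` times. -/
def Setup.sparseSet (R : Setup D A) (q : TState D R.U) (a : A) (k n₀ : ℕ) :
    Set (RunState D R.U A) :=
  {y | y.episode = k ∧ visits y.counts q a < n₀}

theorem two_pow_mul_half_pow_anti (n₀ : ℕ) {m n : ℕ} (h : m ≤ n) :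
    (2 : ℝ≥0∞) ^ n₀ * 2⁻¹ ^ n ≤ 2 ^ n₀ * 2⁻¹ ^ m := by
  exact mul_le_mul_right (pow_le_pow_of_le_one zero_le (ENNReal.inv_le_one.2 one_le_two) h) _

/-- The potential on the right is at least `1` on the target and never increases, since counters
only grow. -/
theorem Setup.hit_sparseSet_le_pow (q : TState D R.U) (a : A) (k n₀ : ℕ)
    (s : RunState D R.U A) :
    hit R.step (R.sparseSet q a k n₀) s ≤ 2 ^ n₀ * 2⁻¹ ^ visits s.counts q a := by
  refine hit_le_of_superharmonic (G := fun s => 2 ^ n₀ * 2⁻¹ ^ visits s.counts q a)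
    (fun s hs => ?_) (fun s _ => ?_) s
  · refine le_trans (le_of_eq ?_) (two_pow_mul_half_pow_anti n₀ hs.2.le)
    rw [← mul_pow, ENNReal.mul_inv_cancel two_ne_zero ENNReal.ofNat_ne_top, one_pow]
  · refine R.expect_step_le (fun _ b Q' => ?_) fun _ b Q' => expect_le_of_forall _ fun m => ?_
    all_goals exact two_pow_mul_half_pow_anti n₀ (R.visits_le_visits_newCounts s b Q' q a)

/-- Episode numbers never decrease. -/
theorem Setup.hit_recordSet_of_lt (q : TState D R.U) (a : A) {k m : ℕ}
    {s : RunState D R.U A} (hs : k < s.episode) : hit R.step (R.recordSet q a k m) s = 0 := by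
  classical
  have h := hit_le_of_superharmonic (K := R.step) (B := R.recordSet q a k m)
    (G := fun s => if k < s.episode then 0 else 1) (fun s hs => ?_) (fun s _ => ?_) s
  · simpa [hs] using h
  · simp [hs.1]
  · by_cases hk : k < s.episode
    · refine R.expect_step_le (fun _ b Q' => ?_) fun _ b Q' => expect_le_of_forall _ fun m => ?_
      · simp [Setup.continued, hk]
      · simp [hk, hk.trans (Nat.lt_succ_self _)]
    · simp only [hk, if_false]
      refine expect_le_of_forall _ fun y => ?_
      split_ifs <;> simp

/-- If exploration in episode `j` records the pair `(q, a)` with probability at least `η j`, then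
the probability that few records have been made before episode `k` is at most a multiple of a
product over the episodes before `k`. -/
theorem Setup.hitBy_sparseSet_le (q : TState D R.U) (a : A) (k n₀ : ℕ) {η : ℕ → ℝ≥0∞}
    (hη1 : ∀ j, η j ≠ ∞)
    (hη : ∀ s : RunState D R.U A, s.plan = none → s.inVisits = 0 →
      η s.episode ≤ hit R.step (R.recordSet q a s.episode (visits s.counts q a)) s)
    {b : ℕ → ℝ≥0∞} (hb : b k = 1) (hb_fin : ∀ j, b j ≠ ∞)
    (hb_succ : ∀ j < k, b j = (1 - ENNReal.ofReal (R.exploreProb j) * (2⁻¹ * η j)) * b (j + 1))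
    (n : ℕ) (s : RunState D R.U A) (hs : s.episode < k) :
    hitBy R.step (R.sparseSet q a k n₀) n s + (if s.plan = none then
      2⁻¹ * (2 ^ n₀ * 2⁻¹ ^ visits s.counts q a * b (s.episode + 1)) *
        hit R.step (R.recordSet q a s.episode (visits s.counts q a)) s else 0) ≤
      2 ^ n₀ * 2⁻¹ ^ visits s.counts q a * b (s.episode + 1) := by
  have half_le : (2⁻¹ : ℝ≥0∞) ≤ 1 := ENNReal.inv_le_one.2 one_le_two
  -- The extra term is what closes the induction: it is the saving expected from the current
  -- exploration episode, whose first new record halves the potential `Z`, weighted by the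
  -- probability of such a record.
  induction n generalizing s with
  | zero =>
    rw [hitBy_zero_of_notMem (fun h => hs.ne h.1), zero_add]
    split_ifs
    · refine (mul_le_of_le_one_right' (hit_le_one _)).trans ?_
      exact mul_le_of_le_one_left' half_le
    · exact zero_le
  | succ n ih =>
    -- At the start of episode `j`, before the coin is thrown, exploration saves `2⁻¹ * η j * Z` and
    -- exploitation saves nothing. Averaging gives the factor `1 - ρ * (2⁻¹ * η j)`, which turns `b
    -- (j + 1)` into `b j`.
    have entry : ∀ j ≤ k, ∀ (Q' : Backlog D) (c : Counts D R.U A),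
        expect (R.drawPlan j c)
          (fun m => hitBy R.step (R.sparseSet q a k n₀) n ⟨Q', c, j, 0, m⟩) ≤
          2 ^ n₀ * 2⁻¹ ^ visits c q a * b j := by
      intro j hj Q' c
      rcases hj.eq_or_lt with rfl | hj
      · rw [hb, mul_one]
        refine expect_le_of_forall _ fun m => ?_
        exact (hitBy_le_hit _ _).trans (Setup.hit_sparseSet_le_pow q a j n₀ _)
      · set Z : ℝ≥0∞ := 2 ^ n₀ * 2⁻¹ ^ visits c q a * b (j + 1) with hZ
        set ρ := ENNReal.ofReal (R.exploreProb j) with hρ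
        have hρ1 : ρ ≤ 1 := by
          rw [hρ, ENNReal.ofReal_le_one]
          exact R.exploreProb_le_one j
        have hZfin : Z ≠ ∞ := ENNReal.mul_ne_top
          (ENNReal.mul_ne_top (by finiteness)
            (ne_top_of_le_ne_top ENNReal.one_ne_top (pow_le_one' half_le _))) (hb_fin _)
        have hnone := ih ⟨Q', c, j, 0, none⟩ hj
        have hsome := ih ⟨Q', c, j, 0, some (R.solve (R.estimate c))⟩ hj
        simp only [if_true, reduceCtorEq, if_false, add_zero] at hnone hsome
        have hη' := hη ⟨Q', c, j, 0, none⟩ rfl rfl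
        simp only at hη'
        have hfin : ρ * (2⁻¹ * η j) * Z ≠ ∞ := by
          refine ENNReal.mul_ne_top (ENNReal.mul_ne_top ENNReal.ofReal_ne_top
            (ENNReal.mul_ne_top ?_ (hη1 j))) hZfin
          exact ne_top_of_le_ne_top ENNReal.one_ne_top half_le
        rw [hb_succ j hj, R.expect_drawPlan, ← hρ, mul_left_comm, ← hZ, ENNReal.sub_mul
          (fun _ _ => hZfin), one_mul]
        refine ENNReal.le_sub_of_add_le_right hfin ?_
        calc ρ * hitBy R.step (R.sparseSet q a k n₀) n ⟨Q', c, j, 0, none⟩ +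
              (1 - ρ) * hitBy R.step (R.sparseSet q a k n₀) n
                ⟨Q', c, j, 0, some (R.solve (R.estimate c))⟩ + ρ * (2⁻¹ * η j) * Z
            = ρ * (hitBy R.step (R.sparseSet q a k n₀) n ⟨Q', c, j, 0, none⟩ +
                2⁻¹ * Z * η j) + (1 - ρ) * hitBy R.step (R.sparseSet q a k n₀) n
                ⟨Q', c, j, 0, some (R.solve (R.estimate c))⟩ := by ring
          _ ≤ ρ * Z + (1 - ρ) * Z := by
            gcongr
            exact le_trans (by gcongr) hnone
          _ = Z := by rw [← add_mul, add_tsub_cancel_of_le hρ1, one_mul]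
    have hanti : ∀ {u v : ℕ}, u ≤ v → 2 ^ n₀ * 2⁻¹ ^ v * b (s.episode + 1) ≤
        2 ^ n₀ * 2⁻¹ ^ u * b (s.episode + 1) := fun h =>
      mul_le_mul_left (two_pow_mul_half_pow_anti n₀ h) _
    have hnext : ∀ (c : A) (Q' : Backlog D),
        expect (R.drawPlan (s.episode + 1) (R.newCounts s c Q'))
          (fun m => hitBy R.step (R.sparseSet q a k n₀) n
            ⟨Q', R.newCounts s c Q', s.episode + 1, 0, m⟩) ≤
          2 ^ n₀ * 2⁻¹ ^ visits s.counts q a * b (s.episode + 1) := fun c Q' =>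
      (entry _ hs Q' _).trans (hanti (R.visits_le_visits_newCounts s c Q' q a))
    have hcont : ∀ (c : A) (Q' : Backlog D),
        hitBy R.step (R.sparseSet q a k n₀) n (R.continued s c Q') ≤
          2 ^ n₀ * 2⁻¹ ^ visits (R.newCounts s c Q') q a * b (s.episode + 1) := fun c Q' =>
      le_self_add.trans (ih (R.continued s c Q') hs)
    rw [hitBy_succ_of_notMem (fun h => hs.ne h.1)]
    by_cases hp : s.plan = none
    · rw [if_pos hp]
      set Z : ℝ≥0∞ := 2 ^ n₀ * 2⁻¹ ^ visits s.counts q a * b (s.episode + 1) with hZ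
      have hrec := hit_le_expect (K := R.step) (x := s)
        (B := R.recordSet q a s.episode (visits s.counts q a)) (fun h => h.2.false)
      refine (add_le_add_right (mul_le_mul_right hrec _) _).trans ?_
      rw [← expect_const_mul, ← expect_add]
      refine R.expect_step_le (fun _ c Q' => ?_) fun _ c Q' => ?_
      · rcases (R.visits_le_visits_newCounts s c Q' q a).eq_or_lt with h | h
        · have := ih (R.continued s c Q') hs
          rw [if_pos (show (R.continued s c Q').plan = none from hp)] at this
          simpa only [Setup.continued, ← h] using this
        -- After a new record the potential is at most `2⁻¹ * Z`, and the saving term is at most the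
        -- other half.
        · refine (add_le_add ((hcont c Q').trans (hanti (Nat.succ_le_of_lt h)))
            (mul_le_of_le_one_right' (hit_le_one _))).trans (le_of_eq ?_)
          have : 2 ^ n₀ * 2⁻¹ ^ (visits s.counts q a).succ * b (s.episode + 1) = 2⁻¹ * Z := by
            rw [hZ, pow_succ]
            ring
          rw [this, ← add_mul, ENNReal.inv_two_add_inv_two, one_mul]
      -- When the episode ends, no further record can be made in it: the saving term vanishes and
      -- the bound at entry takes over.
      · have h0 : ∀ m, hit R.step (R.recordSet q a s.episode (visits s.counts q a))
            ⟨Q', R.newCounts s c Q', s.episode + 1, 0, m⟩ = 0 := fun m =>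
          Setup.hit_recordSet_of_lt q a (Nat.lt_succ_self _)
        simp only [h0, mul_zero, add_zero]
        exact hnext c Q'
    · rw [if_neg hp, add_zero]
      refine R.expect_step_le (fun _ c Q' => ?_) fun _ c Q' => hnext c Q'
      exact (hcont c Q').trans (hanti (R.visits_le_visits_newCounts s c Q' q a))

/-- Comparison with the harmonic series through `1 / j ≤ 1 / √j`. -/
theorem tendsto_sum_exploreProb (R : Setup D A) :
    Tendsto (fun k => ∑ j ∈ Finset.range k, R.exploreProb j) atTop atTop := by
  refine (not_summable_iff_tendsto_nat_atTop_of_nonneg fun j =>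
    div_nonneg R.ℓ_pos.le (Real.sqrt_nonneg _)).1 fun h => ?_
  refine Real.not_summable_one_div_natCast ?_
  refine Summable.of_nonneg_of_le (fun j => by positivity) (fun j => ?_) (h.mul_left R.ℓ⁻¹)
  have h1 : R.ℓ⁻¹ * R.exploreProb j = 1 / √(j : ℝ) := by
    rw [Setup.exploreProb, ← mul_div_assoc, inv_mul_cancel₀ R.ℓ_pos.ne']
  refine le_of_le_of_eq ?_ h1.symm
  rcases Nat.eq_zero_or_pos j with rfl | hj
  · simp
  · have hj1 : (1 : ℝ) ≤ j := by exact_mod_cast hj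
    refine one_div_le_one_div_of_le (Real.sqrt_pos.2 (by linarith)) ?_
    exact Real.sqrt_le_iff.2 ⟨by linarith, by nlinarith⟩

/-- By `1 - x ≤ exp (-x)` the product is at most the exponential of minus a divergent sum. It starts
at `2` because the plan of episode `1` is already drawn in the states considered later. -/
theorem tendsto_prod_one_sub_exploreProb (R : Setup D A) {e : ℝ} (he : 0 < e) (K : ℕ) :
    Tendsto (fun k => ∏ j ∈ Finset.Ico 2 k, (1 - ENNReal.ofReal (R.exploreProb j) *
      (2⁻¹ * if K ≤ j then ENNReal.ofReal e else 0))) atTop (𝓝 0) := by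
  have hnn : ∀ j, 0 ≤ R.exploreProb j := fun j => div_nonneg R.ℓ_pos.le (Real.sqrt_nonneg _)
  have hterm : ∀ j, (1 - ENNReal.ofReal (R.exploreProb j) *
      (2⁻¹ * if K ≤ j then ENNReal.ofReal e else 0)) ≤
      ENNReal.ofReal (Real.exp (-(e / 2 * if K ≤ j then R.exploreProb j else 0))) := by
    intro j
    split_ifs with hj
    · have h1 : ENNReal.ofReal (R.exploreProb j) * (2⁻¹ * ENNReal.ofReal e) =
          ENNReal.ofReal (e / 2 * R.exploreProb j) := by
        rw [ENNReal.ofReal_mul (by positivity), ENNReal.ofReal_div_of_pos two_pos,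
          ENNReal.div_eq_inv_mul]
        simp only [ENNReal.ofReal_ofNat]
        ring
      rw [h1, ← ENNReal.ofReal_one, ← ENNReal.ofReal_sub _ (by have := hnn j; positivity)]
      refine ENNReal.ofReal_le_ofReal ?_
      linarith [Real.add_one_le_exp (-(e / 2 * R.exploreProb j))]
    · simp
  have hbound : ∀ k, ∏ j ∈ Finset.Ico 2 k, (1 - ENNReal.ofReal (R.exploreProb j) *
      (2⁻¹ * if K ≤ j then ENNReal.ofReal e else 0)) ≤ ENNReal.ofReal (Real.exp
        (-(e / 2 * ∑ j ∈ Finset.Ico 2 k, if K ≤ j then R.exploreProb j else 0))) := by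
    intro k
    refine (Finset.prod_le_prod' fun j _ => hterm j).trans (le_of_eq ?_)
    rw [← ENNReal.ofReal_prod_of_nonneg fun _ _ => (Real.exp_pos _).le, ← Real.exp_sum,
      Finset.sum_neg_distrib, Finset.mul_sum]
  refine tendsto_of_tendsto_of_tendsto_of_le_of_le tendsto_const_nhds ?_ (fun _ => zero_le) hbound
  rw [← ENNReal.ofReal_zero]
  refine ENNReal.tendsto_ofReal (Real.tendsto_exp_neg_atTop_nhds_zero.comp ?_)
  refine Tendsto.const_mul_atTop (by positivity) ?_
  refine tendsto_atTop_mono' atTop ?_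
    (tendsto_atTop_add_const_right _ (-∑ j ∈ Finset.range (max 2 K), R.exploreProb j)
      (tendsto_sum_exploreProb R))
  filter_upwards [eventually_ge_atTop (max 2 K)] with k hk
  rw [← sub_eq_add_neg, ← Finset.sum_Ico_eq_sub _ hk]
  calc ∑ j ∈ Finset.Ico (max 2 K) k, R.exploreProb j
      = ∑ j ∈ Finset.Ico (max 2 K) k, if K ≤ j then R.exploreProb j else 0 :=
        Finset.sum_congr rfl fun j hj => by
          rw [if_pos ((le_max_right 2 K).trans (Finset.mem_Ico.1 hj).1)]
    _ ≤ ∑ j ∈ Finset.Ico 2 k, if K ≤ j then R.exploreProb j else 0 :=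
        Finset.sum_le_sum_of_subset_of_nonneg
          (Finset.Ico_subset_Ico_left (le_max_left 2 K)) fun j _ _ => by
            split_ifs
            exacts [hnn j, le_rfl]

/-- Every state-action pair has been recorded at least `n₀` times before a late episode, with
probability close to one. -/
theorem Setup.exists_tendsto_hit_sparseSet
    (hrec : ∀ Q, hit (chainStep R.M.p R.explorePolicy) R.Sin Q = 1)
    (hirr : IrreducibleUnder R.M.p R.explorePolicy) (q : TState D R.U) (a : A) (n₀ : ℕ) :
    ∃ B : ℕ → ℝ≥0∞, Tendsto B atTop (𝓝 0) ∧ ∀ k, 1 < k → ∀ s : RunState D R.U A,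
      s.episode = 1 → hit R.step (R.sparseSet q a k n₀) s ≤ B k := by
  obtain ⟨η, hη0, K, hK⟩ := Setup.exists_le_hit_recordSet hrec hirr q a
  -- Capping at `1` keeps the rate finite for the passage to real numbers. Before episode `K` the
  -- rate is set to `0`, for which the lower bound on recording is trivial.
  have hmin : min η 1 ≠ ∞ := ne_top_of_le_ne_top ENNReal.one_ne_top (min_le_right _ _)
  have he : 0 < (min η 1).toReal :=
    ENNReal.toReal_pos (lt_min (pos_iff_ne_zero.2 hη0) one_pos).ne' hmin
  have hlim := tendsto_prod_one_sub_exploreProb R he K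
  rw [ENNReal.ofReal_toReal hmin] at hlim
  refine ⟨fun k => 2 ^ n₀ * ∏ j ∈ Finset.Ico 2 k, (1 - ENNReal.ofReal (R.exploreProb j) *
      (2⁻¹ * if K ≤ j then min η 1 else 0)), ?_, fun k hk s hs => iSup_le fun n => ?_⟩
  · simpa using ENNReal.Tendsto.const_mul hlim (Or.inr (by finiteness : (2 : ℝ≥0∞) ^ n₀ ≠ ∞))
  · have h := Setup.hitBy_sparseSet_le q a k n₀ (η := fun j => if K ≤ j then min η 1 else 0)
      (fun j => by split_ifs <;> simp [hmin]) (fun s hp hv => ?_)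
      (b := fun i => ∏ j ∈ Finset.Ico i k, (1 - ENNReal.ofReal (R.exploreProb j) *
        (2⁻¹ * if K ≤ j then min η 1 else 0))) (by simp) (fun j => ?_) (fun j hj => ?_) n s
      (hs ▸ hk)
    · refine le_self_add.trans (h.trans ?_)
      rw [hs]
      refine mul_le_mul_left ?_ _
      exact mul_le_of_le_one_right' (pow_le_one' (ENNReal.inv_le_one.2 one_le_two) _)
    · split_ifs with h
      · exact (min_le_left _ _).trans (hK _ h s rfl hp hv)
      · exact zero_le
    · exact ne_top_of_le_ne_top ENNReal.one_ne_top
        (Finset.prod_le_one' fun _ _ => tsub_le_self)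
    · exact Finset.prod_eq_prod_Ico_succ_bot hj _

/-! ### Concentration of the empirical frequencies -/

theorem Setup.expect_update_counts (s : RunState D R.U A) (a : A) (Q' : Backlog D)
    (g : Counts D R.U A → ℝ≥0∞) :
    expect (R.update s a Q') (fun y => g y.counts) = g (R.newCounts s a Q') := by
  by_cases h : (R.newVisits s : ℝ) < R.L * √s.episode
  · rw [R.expect_update_continued h]
    rfl
  · rw [R.expect_update_next h]
    exact expect_const (R.drawPlan (s.episode + 1) (R.newCounts s a Q')) (g (R.newCounts s a Q'))

theorem expect_ofReal {S : Type*} [Fintype S] (μ : PMF S) {h : S → ℝ} (hh : ∀ x, 0 ≤ h x) :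
    expect μ (fun x => ENNReal.ofReal (h x)) = ENNReal.ofReal (∑ x, (μ x).toReal * h x) := by
  rw [expect, tsum_fintype,
    ENNReal.ofReal_sum_of_nonneg fun x _ => mul_nonneg ENNReal.toReal_nonneg (hh x)]
  refine Finset.sum_congr rfl fun x _ => ?_
  rw [ENNReal.ofReal_mul ENNReal.toReal_nonneg, ENNReal.ofReal_toReal (PMF.apply_ne_top _ _)]

theorem sum_toReal_eq_one {S : Type*} [Fintype S] (μ : PMF S) : ∑ x, (μ x).toReal = 1 := by
  have h := expect_ofReal μ (h := fun _ => 1) fun _ => zero_le_one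
  rw [expect_const] at h
  simpa using h.symm

/-- The exponential moment of a centred indicator. -/
theorem sum_mul_exp_le {S : Type*} [Fintype S] [DecidableEq S] (μ : PMF S) (x₀ : S) {θ : ℝ}
    (hθ : |θ| ≤ 1) :
    ∑ x, (μ x).toReal * Real.exp (θ * ((if x = x₀ then 1 else 0) - (μ x₀).toReal)) ≤
      Real.exp (θ ^ 2) := by
  set p := (μ x₀).toReal with hp
  have hp0 : 0 ≤ p := ENNReal.toReal_nonneg
  have hp1 : p ≤ 1 := ENNReal.toReal_le_of_le_ofReal zero_le_one (by simpa using μ.coe_le_one x₀)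
  -- Uses `exp t ≤ 1 + t + t ^ 2` for `|t| ≤ 1`; the linear term averages to zero.
  have hexp : ∀ x, Real.exp (θ * ((if x = x₀ then 1 else 0) - p)) ≤
      1 + θ * ((if x = x₀ then 1 else 0) - p) + θ ^ 2 := by
    intro x
    set u : ℝ := (if x = x₀ then 1 else 0) - p with hu
    have hu1 : |u| ≤ 1 := by
      rw [abs_le, hu]
      split_ifs <;> constructor <;> linarith
    have h1 : |θ * u| ≤ 1 := by
      rw [abs_mul]
      exact mul_le_one₀ hθ (abs_nonneg _) hu1
    have h2 := (abs_le.1 (Real.abs_exp_sub_one_sub_id_le h1)).2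
    have h3 : (θ * u) ^ 2 ≤ θ ^ 2 := by
      rw [mul_pow]
      have : u ^ 2 ≤ 1 := (sq_le_one_iff_abs_le_one u).2 hu1
      nlinarith [sq_nonneg θ]
    linarith
  calc ∑ x, (μ x).toReal * Real.exp (θ * ((if x = x₀ then 1 else 0) - p))
      ≤ ∑ x, (μ x).toReal * (1 + θ * ((if x = x₀ then 1 else 0) - p) + θ ^ 2) :=
        Finset.sum_le_sum fun x _ => mul_le_mul_of_nonneg_left (hexp x) ENNReal.toReal_nonneg
    _ = (1 - θ * p + θ ^ 2) * ∑ x, (μ x).toReal +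
          θ * ∑ x, (μ x).toReal * (if x = x₀ then 1 else 0) := by
        rw [Finset.mul_sum, Finset.mul_sum, ← Finset.sum_add_distrib]
        exact Finset.sum_congr rfl fun x _ => by ring
    _ = 1 + θ ^ 2 := by
        rw [sum_toReal_eq_one]
        simp only [mul_ite, mul_one, mul_zero, Finset.sum_ite_eq', Finset.mem_univ, if_true, ← hp]
        ring
    _ ≤ Real.exp (θ ^ 2) := by linarith [Real.add_one_le_exp (θ ^ 2)]

/-- The deviation of the number of recorded transitions from its compensator. -/
def Setup.deviation (R : Setup D A) (q : TState D R.U) (a : A) (q' : TState D R.U)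
    (c : Counts D R.U A) : ℝ :=
  c q a q' - (truncKernel R.M R.U q a q').toReal * visits c q a

/-- A slot either leaves both statistics of the pair unchanged or adds a centred indicator to the
deviation, whose exponential moment is paid for by the extra `θ ^ 2`. The bound holds for each
action separately, so the way in which actions are chosen is irrelevant. -/
theorem Setup.expect_step_exp_le (q : TState D R.U) (a : A) (q' : TState D R.U) {θ : ℝ}
    (hθ : |θ| ≤ 1) (s : RunState D R.U A) :
    expect (R.step s) (fun y => ENNReal.ofReal
      (Real.exp (θ * R.deviation q a q' y.counts - θ ^ 2 * visits y.counts q a))) ≤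
      ENNReal.ofReal
        (Real.exp (θ * R.deviation q a q' s.counts - θ ^ 2 * visits s.counts q a)) := by
  classical
  rw [R.expect_step]
  refine expect_le_of_forall _ fun b => ?_
  have hupd : ∀ Q', expect (R.update s b Q') (fun y => ENNReal.ofReal
      (Real.exp (θ * R.deviation q a q' y.counts - θ ^ 2 * visits y.counts q a))) =
      ENNReal.ofReal (Real.exp (θ * R.deviation q a q' (R.newCounts s b Q') -
        θ ^ 2 * visits (R.newCounts s b Q') q a)) := fun Q' =>
    Setup.expect_update_counts s b Q' fun c => ENNReal.ofReal
      (Real.exp (θ * R.deviation q a q' c - θ ^ 2 * visits c q a))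
  simp only [hupd]
  by_cases h : s.Q = emb q ∧ b = a
  · obtain ⟨hQ, rfl⟩ := h
    set Z := Real.exp (θ * R.deviation q b q' s.counts - θ ^ 2 * visits s.counts q b) with hZ
    set p := (truncKernel R.M R.U q b q').toReal with hp
    have hrw : ∀ Q', ENNReal.ofReal (Real.exp (θ * R.deviation q b q' (R.newCounts s b Q') -
        θ ^ 2 * visits (R.newCounts s b Q') q b)) =
        ENNReal.ofReal (Z * Real.exp (-θ ^ 2)) * ENNReal.ofReal
          (Real.exp (θ * ((if clip R.U Q' = q' then 1 else 0) - p))) := by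
      intro Q'
      rw [← ENNReal.ofReal_mul (by positivity), hZ, ← Real.exp_add, ← Real.exp_add]
      congr 2
      simp only [Setup.deviation, R.newCounts_apply, R.visits_newCounts, hQ, ← hp]
      push_cast
      simp only [true_and, if_true]
      ring
    simp only [hrw]
    have hmap : expect (R.M.p s.Q b) (fun Q' => ENNReal.ofReal
        (Real.exp (θ * ((if clip R.U Q' = q' then 1 else 0) - p)))) =
        expect (truncKernel R.M R.U q b) (fun x => ENNReal.ofReal
          (Real.exp (θ * ((if x = q' then 1 else 0) - p)))) := by
      rw [truncKernel, expect_map, hQ]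
    rw [expect_const_mul, hmap, expect_ofReal _ fun _ => (Real.exp_pos _).le,
      ← ENNReal.ofReal_mul (by positivity)]
    refine ENNReal.ofReal_le_ofReal ?_
    calc Z * Real.exp (-θ ^ 2) * _ ≤ Z * Real.exp (-θ ^ 2) * Real.exp (θ ^ 2) :=
          mul_le_mul_of_nonneg_left (sum_mul_exp_le _ q' hθ) (by positivity)
      _ = Z := by rw [mul_assoc, ← Real.exp_add, neg_add_cancel, Real.exp_zero, mul_one]
  · refine expect_le_of_forall _ fun Q' => le_of_eq ?_
    have h1 : R.newCounts s b Q' q a q' = s.counts q a q' := by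
      rw [R.newCounts_apply, if_neg fun h' => h ⟨h'.1, h'.2.1⟩, add_zero]
    have h2 : visits (R.newCounts s b Q') q a = visits s.counts q a := by
      rw [R.visits_newCounts, if_neg h, add_zero]
    simp only [Setup.deviation, h1, h2]

/-- The states at which the pair `(q, a)` has been recorded at least `n₀` times and the deviation
is large in the direction given by the sign of `θ`. -/
def Setup.deviationSet (R : Setup D A) (q : TState D R.U) (a : A) (q' : TState D R.U)
    (n₀ : ℕ) (θ : ℝ) : Set (RunState D R.U A) :=
  {y | n₀ ≤ visits y.counts q a ∧
    2 * θ ^ 2 * visits y.counts q a ≤ θ * R.deviation q a q' y.counts}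

/-- Maximal inequality: on the target the exponent of the supermartingale is at least `θ ^ 2 *
visits ≥ θ ^ 2 * n₀`, while with empty counters it is zero. -/
theorem Setup.hit_deviationSet_le (q : TState D R.U) (a : A) (q' : TState D R.U) (n₀ : ℕ)
    {θ : ℝ} (hθ : |θ| ≤ 1) (s : RunState D R.U A) (hs : s.counts = fun _ _ _ => 0) :
    hit R.step (R.deviationSet q a q' n₀ θ) s ≤ ENNReal.ofReal (Real.exp (-(θ ^ 2 * n₀))) := by
  have h := hit_le_of_superharmonic (K := R.step) (B := R.deviationSet q a q' n₀ θ)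
    (G := fun y => ENNReal.ofReal (Real.exp (-(θ ^ 2 * n₀))) * ENNReal.ofReal
      (Real.exp (θ * R.deviation q a q' y.counts - θ ^ 2 * visits y.counts q a)))
    (fun y hy => ?_) (fun y _ => ?_) s
  · refine h.trans (le_of_eq ?_)
    simp [hs, Setup.deviation, visits]
  · rw [← ENNReal.ofReal_mul (Real.exp_pos _).le, ← Real.exp_add, ← ENNReal.ofReal_one]
    refine ENNReal.ofReal_le_ofReal (Real.one_le_exp ?_)
    have h1 : (n₀ : ℝ) ≤ visits y.counts q a := by exact_mod_cast hy.1
    nlinarith [hy.2, mul_le_mul_of_nonneg_left h1 (sq_nonneg θ)]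
  · rw [expect_const_mul]
    gcongr
    exact Setup.expect_step_exp_le q a q' hθ y

end


section

variable {D : ℕ} {A : Type*} [Fintype A] [Nonempty A] {R : Setup D A}

/-! ### The plan of a late episode -/

theorem Setup.estimate_apply_toReal {c : Counts D R.U A} {q : TState D R.U} {a : A}
    (h : visits c q a ≠ 0) (q' : TState D R.U) :
    (R.estimate c q a q').toReal = (c q a q' : ℝ) / visits c q a := by
  simp [Setup.estimate, h]

/-- If all pairs have been recorded often and no deviation is large, the estimated kernel is close
to the true one. -/
theorem Setup.sum_abs_sub_estimate_le {θ : ℝ} (hθ : 0 < θ) {n₀ : ℕ} (hn₀ : 0 < n₀)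
    {y : RunState D R.U A} (hvis : ∀ q a, n₀ ≤ visits y.counts q a)
    (hdev : ∀ q a q', y ∉ R.deviationSet q a q' n₀ θ ∧ y ∉ R.deviationSet q a q' n₀ (-θ))
    (q : TState D R.U) (a : A) :
    ∑ q', |(truncKernel R.M R.U q a q').toReal - (R.estimate y.counts q a q').toReal| ≤
      Fintype.card (TState D R.U) * (2 * θ) := by
  have hpos : 0 < visits y.counts q a := hn₀.trans_le (hvis q a)
  have hN : (0 : ℝ) < visits y.counts q a := by exact_mod_cast hpos
  have hterm : ∀ q' ∈ Finset.univ,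
      |(truncKernel R.M R.U q a q').toReal - (R.estimate y.counts q a q').toReal| ≤ 2 * θ := by
    intro q' _
    obtain ⟨h1, h2⟩ := hdev q a q'
    have h1' : θ * R.deviation q a q' y.counts < θ * (2 * θ * visits y.counts q a) := by
      by_contra! h
      exact h1 ⟨hvis q a, le_trans (by ring_nf; rfl) h⟩
    have h2' : θ * -R.deviation q a q' y.counts < θ * (2 * θ * visits y.counts q a) := by
      by_contra! h
      exact h2 ⟨hvis q a, le_trans (by ring_nf; rfl) (h.trans (by ring_nf; rfl))⟩
    have h3 := lt_of_mul_lt_mul_left h1' hθ.le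
    have h4 := lt_of_mul_lt_mul_left h2' hθ.le
    have heq : (truncKernel R.M R.U q a q').toReal - (R.estimate y.counts q a q').toReal =
        -R.deviation q a q' y.counts / visits y.counts q a := by
      rw [Setup.estimate_apply_toReal hpos.ne', Setup.deviation]
      field_simp
      ring
    rw [heq, abs_le, le_div_iff₀ hN, div_le_iff₀ hN]
    constructor <;> linarith
  refine (Finset.sum_le_sum hterm).trans (le_of_eq ?_)
  simp

/-- A bound for the probability that the plan of episode `k` is not the optimal policy, by the
probability `T` of a misleading estimate and the probability of exploration. -/
theorem Setup.hit_wrong_plan_le {πopt : TState D R.U → A} {k : ℕ}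
    {T : RunState D R.U A → ℝ≥0∞} (hT : ∀ s, expect (R.step s) T ≤ T s)
    (hbad : ∀ y : RunState D R.U A, y.episode = k → R.solve (R.estimate y.counts) ≠ πopt →
      1 ≤ T y)
    (s : RunState D R.U A) (hs : s.episode < k) :
    hit R.step {y | y.episode = k ∧ y.plan ≠ some πopt} s ≤
      T s + ENNReal.ofReal (R.exploreProb k) := by
  classical
  set r := ENNReal.ofReal (R.exploreProb k) with hr
  -- Before episode `k` the risk is `T + r`; in episode `k` it is decided by the plan, which no
  -- longer changes; afterwards it is zero.
  set G : RunState D R.U A → ℝ≥0∞ := fun s =>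
    if s.episode < k then T s + r else if s.episode = k ∧ s.plan ≠ some πopt then 1 else 0
    with hG
  have hGlt : ∀ y : RunState D R.U A, y.episode < k → G y = T y + r := fun y hy => by
    simp [hG, hy]
  have hGle : ∀ y : RunState D R.U A, G y ≤ if y.episode < k then T y + r else 1 := fun y => by
    simp only [hG]
    split_ifs <;> simp
  rw [← hGlt s hs]
  refine hit_le_of_superharmonic (fun y hy => ?_) (fun y hy => ?_) s
  · simp [hG, hy.1, hy.2]
  · rcases lt_trichotomy y.episode k with h | h | h
    · rw [hGlt y h]
      have hupd : ∀ a Q', expect (R.update y a Q') G ≤ expect (R.update y a Q') T + r := by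
        intro a Q'
        by_cases hv : (R.newVisits y : ℝ) < R.L * √y.episode
        · rw [R.expect_update_continued hv, R.expect_update_continued hv]
          exact (hGlt (R.continued y a Q') h).le
        · rw [R.expect_update_next hv, R.expect_update_next hv]
          rcases (Nat.succ_le_of_lt h).lt_or_eq with h' | h'
          · rw [← expect_const (R.drawPlan (y.episode + 1) (R.newCounts y a Q')) r, ← expect_add]
            exact expect_mono _ fun m => (hGlt _ h').le
          · have h'' : y.episode + 1 = k := h'
            -- The coin for episode `k`: the exploring branch is charged to `r`, the exploiting one
            -- to `T`, which is at least `1` whenever the solver returns a wrong policy.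
            rw [R.expect_drawPlan, R.expect_drawPlan, h'', ← hr, add_comm]
            refine add_le_add (le_trans ?_ le_add_self) ?_
            · refine mul_le_mul_right ?_ _
              by_cases hb : R.solve (R.estimate (R.newCounts y a Q')) = πopt
              · simp [hG, hb]
              · exact ((hGle _).trans (by simp)).trans (hbad _ rfl hb)
            · refine mul_le_of_le_one_right' ((hGle _).trans ?_)
              simp
      rw [R.expect_step]
      calc expect (R.action y) (fun a => expect (R.M.p y.Q a) fun Q' =>
            expect (R.update y a Q') G)
          ≤ expect (R.action y) (fun a => expect (R.M.p y.Q a) fun Q' =>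
            expect (R.update y a Q') T + r) :=
            expect_mono _ fun a => expect_mono _ fun Q' => hupd a Q'
        _ = expect (R.step y) T + r := by
            simp only [expect_add, expect_const, R.expect_step]
        _ ≤ T y + r := by gcongr; exact hT y
    · have hp : y.plan = some πopt := by
        by_contra hp
        exact hy ⟨h, hp⟩
      refine (R.expect_step_le (c := 0) (fun _ a Q' => ?_) fun _ a Q' =>
        expect_le_of_forall _ fun m => ?_).trans zero_le
      · simp [hG, Setup.continued, h, hp]
      · simp [hG, h]
    · refine (R.expect_step_le (c := 0) (fun _ a Q' => ?_) fun _ a Q' =>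
        expect_le_of_forall _ fun m => ?_).trans zero_le
      · simp [hG, Setup.continued, h.not_gt, h.ne']
      · simp [hG, (h.trans (Nat.lt_succ_self _)).not_gt, (h.trans (Nat.lt_succ_self _)).ne']

instance : Countable (RunState D R.U A) := by
  have : Function.Injective (fun s : RunState D R.U A =>
      (s.Q, s.counts, s.episode, s.inVisits, s.plan)) := by
    intro s t h
    simp only [Prod.mk.injEq] at h
    exact RunState.ext h.1 h.2.1 h.2.2.1 h.2.2.2.1 h.2.2.2.2
  exact this.countable

instance : MeasurableSingletonClass (RunState D R.U A) := ⟨fun _ => trivial⟩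

theorem Setup.expect_start_le {μ₀ : PMF (Backlog D)} {f : RunState D R.U A → ℝ≥0∞} {c : ℝ≥0∞}
    (h : ∀ s : RunState D R.U A, s.episode = 1 → (s.counts = fun _ _ _ => 0) → f s ≤ c) :
    expect (R.start μ₀) f ≤ c := by
  rw [Setup.start, expect_bind]
  refine expect_le_of_forall _ fun Q => ?_
  rw [expect_map]
  exact expect_le_of_forall _ fun m => h _ rfl rfl

theorem Setup.le_expect_start {μ₀ : PMF (Backlog D)} {f : RunState D R.U A → ℝ≥0∞} {c : ℝ≥0∞}
    (h : ∀ s : RunState D R.U A, s.episode = 1 → (s.counts = fun _ _ _ => 0) → c ≤ f s) :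
    c ≤ expect (R.start μ₀) f := by
  rw [Setup.start, expect_bind]
  refine le_expect_of_forall _ fun Q => ?_
  rw [expect_map]
  exact le_expect_of_forall _ fun m => h _ rfl rfl

/-- The plan of a late episode is the optimal policy with probability close to one. -/
theorem Setup.exists_hit_wrong_plan_le {πopt : TState D R.U → A}
    (hsolve : IsExactSolver R.solve) (herr : ErrorTolerant R.M R.U πopt)
    (hrec : ∀ Q, hit (chainStep R.M.p R.explorePolicy) R.Sin Q = 1)
    (hirr : IrreducibleUnder R.M.p R.explorePolicy) {δ : ℝ} (hδ : 0 < δ) :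
    ∃ k, 1 < k ∧ ∀ s : RunState D R.U A, s.episode = 1 → (s.counts = fun _ _ _ => 0) →
      hit R.step {y | y.episode = k ∧ y.plan ≠ some πopt} s ≤ ENNReal.ofReal δ := by
  obtain ⟨Δ, hΔ, hopt⟩ := herr
  have hcard : (0 : ℝ) < Fintype.card (TState D R.U) := by exact_mod_cast Fintype.card_pos
  -- Each entry of the estimate will be off by at most `2 * θ`, so an `L¹` distance of at most `Δ`
  -- requires `card * (2 * θ) ≤ Δ`; the cap `1` is required by the exponential moment bound.
  set θ : ℝ := min 1 (Δ / (Fintype.card (TState D R.U) * 2)) with hθdef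
  have hθ : 0 < θ := lt_min one_pos (by positivity)
  have hθ1 : |θ| ≤ 1 := by
    rw [abs_of_pos hθ]
    exact min_le_left _ _
  have hθΔ : Fintype.card (TState D R.U) * (2 * θ) ≤ Δ := by
    have h := (le_div_iff₀ (by positivity)).1 (min_le_right 1
      (Δ / (Fintype.card (TState D R.U) * 2)))
    rw [← hθdef] at h
    linarith
  have hδ3 : 0 < ENNReal.ofReal (δ / 3) := ENNReal.ofReal_pos.2 (by linarith)
  -- The concentration bound fixes `n₀` before `k` is chosen: it does not depend on the episode,
  -- whereas the rate at which `n₀` records accumulate depends on `n₀`.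
  obtain ⟨n₀, hn₀, hn₀pos⟩ : ∃ n₀ : ℕ, (∑ _q : TState D R.U, ∑ _a : A, ∑ _q' : TState D R.U,
      (ENNReal.ofReal (Real.exp (-(θ ^ 2 * n₀))) + ENNReal.ofReal (Real.exp (-(θ ^ 2 * n₀)))) ≤
      ENNReal.ofReal (δ / 3)) ∧ 0 < n₀ := by
    have h1 : Tendsto (fun n : ℕ => ENNReal.ofReal (Real.exp (-(θ ^ 2 * n)))) atTop (𝓝 0) := by
      rw [← ENNReal.ofReal_zero]
      exact ENNReal.tendsto_ofReal (Real.tendsto_exp_neg_atTop_nhds_zero.comp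
        (tendsto_natCast_atTop_atTop.const_mul_atTop (by positivity)))
    have h2 := tendsto_finsetSum (Finset.univ : Finset (TState D R.U)) fun _ _ =>
      tendsto_finsetSum (Finset.univ : Finset A) fun _ _ =>
        tendsto_finsetSum (Finset.univ : Finset (TState D R.U)) fun _ _ => h1.add h1
    simp only [add_zero, Finset.sum_const_zero] at h2
    exact ((h2.eventually_le_const hδ3).and (eventually_gt_atTop 0)).exists
  choose B hB0 hB using fun q a => Setup.exists_tendsto_hit_sparseSet hrec hirr q a n₀
  obtain ⟨k, hk, hkr, hk1⟩ : ∃ k, ∑ q, ∑ a, B q a k ≤ ENNReal.ofReal (δ / 3) ∧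
      ENNReal.ofReal (R.exploreProb k) ≤ ENNReal.ofReal (δ / 3) ∧ 1 < k := by
    have h1 := tendsto_finsetSum Finset.univ fun q _ =>
      tendsto_finsetSum Finset.univ fun a _ => hB0 q a
    simp only [Finset.sum_const_zero] at h1
    have h2 : Tendsto (fun k => ENNReal.ofReal (R.exploreProb k)) atTop (𝓝 0) := by
      rw [← ENNReal.ofReal_zero]
      exact ENNReal.tendsto_ofReal (tendsto_const_nhds.div_atTop
        (Real.tendsto_sqrt_atTop.comp tendsto_natCast_atTop_atTop))
    exact ((h1.eventually_le_const hδ3).and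
      ((h2.eventually_le_const hδ3).and (eventually_gt_atTop 1))).exists
  refine ⟨k, hk1, fun s hs hs0 => ?_⟩
  -- The union bound as a superharmonic function: a sum of hitting probabilities of the bad sets.
  let T₁ : RunState D R.U A → ℝ≥0∞ := fun y =>
    ∑ q, ∑ a, hit R.step (R.sparseSet q a k n₀) y
  let T₂ : RunState D R.U A → ℝ≥0∞ := fun y => ∑ q, ∑ a, ∑ q',
    (hit R.step (R.deviationSet q a q' n₀ θ) y + hit R.step (R.deviationSet q a q' n₀ (-θ)) y)
  have hle1 : ∀ y q a, hit R.step (R.sparseSet q a k n₀) y ≤ T₁ y := fun y q a =>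
    (Finset.single_le_sum (f := fun a => hit R.step (R.sparseSet q a k n₀) y)
      (fun _ _ => zero_le) (Finset.mem_univ a)).trans
    (Finset.single_le_sum (f := fun q => ∑ a, hit R.step (R.sparseSet q a k n₀) y)
      (fun _ _ => zero_le) (Finset.mem_univ q))
  have hle2 : ∀ y q a q', hit R.step (R.deviationSet q a q' n₀ θ) y +
      hit R.step (R.deviationSet q a q' n₀ (-θ)) y ≤ T₂ y := fun y q a q' =>
    ((Finset.single_le_sum (f := fun q' => hit R.step (R.deviationSet q a q' n₀ θ) y +
        hit R.step (R.deviationSet q a q' n₀ (-θ)) y)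
      (fun _ _ => zero_le) (Finset.mem_univ q')).trans
    (Finset.single_le_sum (f := fun a => ∑ q', (hit R.step (R.deviationSet q a q' n₀ θ) y +
        hit R.step (R.deviationSet q a q' n₀ (-θ)) y))
      (fun _ _ => zero_le) (Finset.mem_univ a))).trans
    (Finset.single_le_sum (f := fun q => ∑ a, ∑ q',
        (hit R.step (R.deviationSet q a q' n₀ θ) y +
          hit R.step (R.deviationSet q a q' n₀ (-θ)) y))
      (fun _ _ => zero_le) (Finset.mem_univ q))
  have hmain := Setup.hit_wrong_plan_le (R := R) (πopt := πopt) (k := k)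
    (T := fun y => T₁ y + T₂ y) (fun y => ?_) (fun y hy hbad => ?_) s (hs ▸ hk1)
  · refine hmain.trans ?_
    have hsplit : ENNReal.ofReal δ = ENNReal.ofReal (δ / 3) + ENNReal.ofReal (δ / 3) +
        ENNReal.ofReal (δ / 3) := by
      rw [← ENNReal.ofReal_add (by linarith) (by linarith),
        ← ENNReal.ofReal_add (by linarith) (by linarith)]
      congr 1
      ring
    rw [hsplit]
    refine add_le_add (add_le_add (le_trans ?_ hk) (le_trans ?_ hn₀)) hkr
    · exact Finset.sum_le_sum fun q _ => Finset.sum_le_sum fun a _ => hB q a k hk1 s hs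
    · refine Finset.sum_le_sum fun q _ => Finset.sum_le_sum fun a _ =>
        Finset.sum_le_sum fun q' _ => add_le_add (Setup.hit_deviationSet_le q a q' n₀ hθ1 s hs0) ?_
      simpa using Setup.hit_deviationSet_le q a q' n₀ (θ := -θ) (by simpa using hθ1) s hs0
  · simp only [T₁, T₂, expect_add, expect_sum]
    gcongr <;> exact expect_hit_le y
  -- A hitting probability equals `1` on its target, so `T₁ + T₂ < 1` places `y` outside all bad
  -- sets, and error tolerance applies to the estimate.
  · by_contra! hlt
    have hvis : ∀ q a, n₀ ≤ visits y.counts q a := by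
      intro q a
      by_contra! h
      have h1 := hle1 y q a
      rw [hit_of_mem (show y ∈ R.sparseSet q a k n₀ from ⟨hy, h⟩)] at h1
      exact absurd (h1.trans le_self_add) (not_le.2 hlt)
    have hdev : ∀ q a q', y ∉ R.deviationSet q a q' n₀ θ ∧
        y ∉ R.deviationSet q a q' n₀ (-θ) := by
      intro q a q'
      constructor <;> intro h
      · have h1 := le_self_add.trans (hle2 y q a q')
        rw [hit_of_mem h] at h1
        exact absurd (h1.trans le_add_self) (not_le.2 hlt)
      · have h1 := le_add_self.trans (hle2 y q a q')
        rw [hit_of_mem h] at h1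
        exact absurd (h1.trans le_add_self) (not_le.2 hlt)
    have hiff := hopt (R.estimate y.counts) fun q a =>
      (Setup.sum_abs_sub_estimate_le hθ hn₀pos hvis hdev q a).trans hθΔ
    exact hbad ((hiff _).1 (hsolve _ ⟨πopt, (hiff πopt).2 rfl⟩))

end

end RLQN

end

/-! ### Conclusion: episode `k` is reached almost surely and its plan is rarely wrong. -/

theorem theorem1 {D : ℕ} {A : Type*} [Fintype A] [Nonempty A]
    (R : RLQN.Setup D A) (πopt : RLQN.TState D R.U → A)
    (hsolve : RLQN.IsExactSolver R.solve)
    (hstab : RLQN.IsStabilizing R.M R.π₀)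
    (horder : R.HasOrder)
    (hirr_explore : RLQN.IrreducibleUnder R.M.p R.explorePolicy)
    (hirr_exploit : RLQN.IrreducibleUnder R.M.p (R.exploitPolicy πopt))
    (herr : RLQN.ErrorTolerant R.M R.U πopt)
    (μ₀ : PMF (RLQN.Backlog D))
    {Ω : Type*} [MeasurableSpace Ω] (P : MeasureTheory.Measure Ω)
    [MeasureTheory.IsProbabilityMeasure P]
    (X : ℕ → Ω → RLQN.RunState D R.U A) (hX : R.IsRun μ₀ P X)
    (δ : ℝ) (hδ0 : 0 < δ) (hδ1 : δ < 1) :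
    ∃ kstar : ℕ, ENNReal.ofReal (1 - δ) ≤
      P {ω | ∃ t : ℕ, (X t ω).episode = kstar ∧ (X t ω).plan = some πopt} := by
  have hrec_explore := RLQN.Setup.hit_Sin_explore hstab horder hirr_explore
  have hrec : ∀ m Q, RLQN.hit (RLQN.chainStep R.M.p (R.planPolicy m)) R.Sin Q = 1 := by
    rintro (_ | π) Q
    · exact hrec_explore Q
    · exact RLQN.Setup.hit_Sin_exploit hstab horder hirr_exploit π Q
  obtain ⟨k, hk1, hk⟩ :=
    RLQN.Setup.exists_hit_wrong_plan_le hsolve herr hrec_explore hirr_explore hδ0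
  refine ⟨k, ?_⟩
  have hreach : 1 ≤ P {ω | ∃ t, X t ω ∈ {y : RLQN.RunState D R.U A | y.episode = k}} := by
    rw [RLQN.measure_exists_mem_eq hX.measurable hX.initial hX.transition]
    exact RLQN.Setup.le_expect_start fun s hs _ =>
      (RLQN.Setup.hit_episode hrec s (hs ▸ hk1.le)).ge
  have hwrong : P {ω | ∃ t, X t ω ∈ {y : RLQN.RunState D R.U A |
      y.episode = k ∧ y.plan ≠ some πopt}} ≤ ENNReal.ofReal δ := by
    rw [RLQN.measure_exists_mem_eq hX.measurable hX.initial hX.transition]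
    exact RLQN.Setup.expect_start_le hk
  have hcover : {ω | ∃ t, X t ω ∈ {y : RLQN.RunState D R.U A | y.episode = k}} ⊆
      {ω | ∃ t : ℕ, (X t ω).episode = k ∧ (X t ω).plan = some πopt} ∪
        {ω | ∃ t, X t ω ∈ {y : RLQN.RunState D R.U A |
          y.episode = k ∧ y.plan ≠ some πopt}} := by
    rintro ω ⟨t, ht⟩
    by_cases hp : (X t ω).plan = some πopt
    · exact Or.inl ⟨t, ht, hp⟩
    · exact Or.inr ⟨t, ht, hp⟩
  rw [ENNReal.ofReal_sub _ hδ0.le, ENNReal.ofReal_one]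
  refine tsub_le_iff_right.2 (hreach.trans ((MeasureTheory.measure_mono hcover).trans
    ((MeasureTheory.measure_union_le _ _).trans ?_)))
  gcongr
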